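/- Let $k$ be a field of characteristic different from two, let $d\ge 0$ be an integer, and let $0\neq f\in(x_0,\dots,x_d)^2\subseteq k[\![x_0,\dots,x_d]\!]$. Consider the complete equicharacteristic local hypersurface $R=k[\![x_0,\dots,x_d]\!]/(f)$ and its double branched cover $R^\sharp=k[\![x_0,\dots,x_d,y]\!]/(f+y^2)$. For $A\in\{R,R^\sharp\}$ let $\underline{\mathsf{CM}}(A)$ be the stable category of maximal Cohen–Macaulay $A$-modules: its objects are the finitely generated $A$-modules that are zero or have depth $\dim A$, and its morphisms are the $A$-homomorphisms modulo those that factor through a finitely generated free module. It is triangulated, with shift $[1]=\Omega^{-1}$ (cosyzygy) and with exact triangles induced by the short exact sequences of maximal Cohen–Macaulay modules. For a class $\mathcal X$ of objects of a triangulated category $\mathcal T$ let $\langle\mathcal X\rangle$ be the smallest full subcategory of $\mathcal T$ containing $\mathcal X$ and closed under isomorphisms, shifts, finite direct sums and direct summands. Let $\mathcal X*\mathcal Y$ consist of the objects $M$ in an exact triangle $X\to M\to Y\to X[1]$ with $X\in\mathcal X$, $Y\in\mathcal Y$. Put $\mathcal X\diamond\mathcal Y=\langle\langle\mathcal X\rangle*\langle\mathcal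 Y\rangle\rangle$, $\langle\mathcal X\rangle_0=0$, $\langle\mathcal X\rangle_1=\langle\mathcal X\rangle$, and $\langle\mathcal X\rangle_n=\mathcal X\diamond\langle\mathcal X\rangle_{n-1}$ for $n\ge2$; for an object $M$ write $\langle M\rangle_n=\langle\{M\}\rangle_n$. The generation time of $M$ is $\operatorname{gt}_{\mathcal T}(M)=\inf\{n\ge0\mid\mathcal T=\langle M\rangle_{n+1}\}$ (with $\inf\emptyset=\infty$). The Orlov spectrum $\operatorname{OSpec}(\mathcal T)$ is the set of the finite values of $\operatorname{gt}_{\mathcal T}$ on objects of $\mathcal T$, and the Rouquier dimension is $\dim\mathcal T=\inf\operatorname{OSpec}(\mathcal T)\in\mathbb N\cup\{\infty\}$. Then $$\operatorname{OSpec}\underline{\mathsf{CM}}(R)=\operatorname{OSpec}\underline{\mathsf{CM}}(R^\sharp),\qquad \dim\underline{\mathsf{CM}}(R)=\dim\underline{\mathsf{CM}}(R^\sharp).$$ -/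

import Mathlib

open CategoryTheory

universe u

namespace StableMCM

noncomputable section

/-! ## Maximal Cohen-Macaulay modules and the stable category -/

section StableCategory

variable (R : Type u) [CommRing R]

/-- Maximal Cohen-Macaulay modules over a Noetherian local ring `R`: finitely generated modules
which are zero or have depth equal to the Krull dimension of `R`, i.e. admit a regular sequence
of length `dim R`. (The condition `M ≠ (rs) M` contained in `IsRegular` forces the members of `rs`
to be nonunits, so over a local ring `rs` automatically lies in the maximal ideal.) -/
def IsMCM : ObjectProperty (ModuleCat.{u} R) := fun M =>
  Module.Finite R M ∧
    (Subsingleton M ∨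
      ∃ rs : List R, RingTheory.Sequence.IsRegular M rs ∧
        (rs.length : WithBot ℕ∞) = ringKrullDim R)

/-- The category `CM(R)` of maximal Cohen-Macaulay `R`-modules. -/
abbrev CM : Type (u + 1) := (IsMCM R).FullSubcategory

/-- Two homomorphisms of maximal Cohen-Macaulay modules are identified in the stable category
when their difference factors through a finitely generated projective module. -/
def stableRel : HomRel (CM R) := fun X Y f g =>
  ∃ (P : ModuleCat.{u} R) (a : X.obj ⟶ P) (b : P ⟶ Y.obj),
    Module.Finite R P ∧ Module.Projective R P ∧ f.hom - g.hom = a ≫ b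

instance : Congruence (stableRel R) where
  equivalence := by
    intro X Y
    refine ⟨fun f => ?_, ?_, ?_⟩
    · exact ⟨ModuleCat.of R PUnit, 0, 0, inferInstance, inferInstance, by simp⟩
    · rintro f g ⟨P, a, b, h₁, h₂, h⟩
      refine ⟨P, -a, b, h₁, h₂, ?_⟩
      rw [Preadditive.neg_comp, ← h, neg_sub]
    · rintro f g h ⟨P, a, b, hP₁, hP₂, e⟩ ⟨Q, c, d, hQ₁, hQ₂, e'⟩
      refine ⟨ModuleCat.of R (P × Q), ModuleCat.ofHom (LinearMap.prod a.hom c.hom),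
        ModuleCat.ofHom (LinearMap.coprod b.hom d.hom), inferInstanceAs (Module.Finite R (P × Q)),
        inferInstanceAs (Module.Projective R (P × Q)), ?_⟩
      have : f.hom - h.hom = (f.hom - g.hom) + (g.hom - h.hom) := by abel
      rw [this, e, e']
      ext x
      simp
  comp_left := by
    rintro X Y Z f g g' ⟨P, a, b, h₁, h₂, h⟩
    refine ⟨P, f.hom ≫ a, b, h₁, h₂, ?_⟩
    rw [Category.assoc, ← h, Preadditive.comp_sub]
    rfl
  comp_right := by
    rintro X Y Z f f' g ⟨P, a, b, h₁, h₂, h⟩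
    refine ⟨P, a, b ≫ g.hom, h₁, h₂, ?_⟩
    rw [← Category.assoc, ← h, Preadditive.sub_comp]
    rfl

/-- The stable category of maximal Cohen-Macaulay `R`-modules. -/
abbrev StableCM : Type (u + 1) := Quotient (stableRel R)

/-- The canonical functor from `CM(R)` to the stable category. -/
abbrev toStable : CM R ⥤ StableCM R := Quotient.functor (stableRel R)

end StableCategory

/-! ## The triangulated structure of the stable category -/

section Triangles

variable {R : Type u} [CommRing R]

/-- `0 ⟶ X ⟶ Y ⟶ Z ⟶ 0` is a short exact sequence of `R`-modules. -/
def IsSES {X Y Z : ModuleCat.{u} R} (i : X ⟶ Y) (p : Y ⟶ Z) : Prop :=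
  ∃ w : i ≫ p = 0, (ShortComplex.mk i p w).ShortExact

/-- A cosyzygy sequence `0 ⟶ X ⟶ F ⟶ X' ⟶ 0` of a maximal Cohen-Macaulay module `X`, with `F`
finitely generated projective and `X'` maximal Cohen-Macaulay. The module `X' = Ω⁻¹ X` represents
the shift `X[1]` in the stable category. -/
structure Cosyzygy (X : CM R) where
  /-- the projective module in the middle -/
  F : ModuleCat.{u} R
  finite : Module.Finite R F
  projective : Module.Projective R F
  /-- the cosyzygy of `X` -/
  shift : CM R
  /-- the inclusion of `X` -/
  ι : X.obj ⟶ F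
  /-- the projection onto the cosyzygy -/
  π : F ⟶ shift.obj
  ses : IsSES ι π

/-- `B ≅ A[1]` in the stable category; equivalently `A ≅ B[-1]`. -/
def IsShift (A B : StableCM R) : Prop :=
  ∃ ξ : Cosyzygy A.as, Nonempty ((toStable R).obj ξ.shift ≅ B)

/-- The exact triangles `A ⟶ B ⟶ C ⟶ A[1]` of the stable category, the shift `A[1] = Ω⁻¹ A` being
computed by the cosyzygy sequence `ξ : 0 ⟶ A ⟶ F ⟶ A[1] ⟶ 0`.

They are the triangles isomorphic, by an isomorphism that is the identity on `A` and `A[1]`, to the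
triangle `A ⟶ Y ⟶ Z ⟶ A[1]` attached to a short exact
sequence `0 ⟶ A ⟶ Y ⟶ Z ⟶ 0` of maximal Cohen-Macaulay modules, whose connecting morphism
`δ : Z ⟶ A[1]` is obtained from a map `b : Y ⟶ F` extending `A ⟶ F` by passing to cokernels.
The sign is the usual one: for the pushout `Z` of `u : A ⟶ B` and `A ⟶ F`, i.e. the sequence
`0 ⟶ A ⟶ B ⊕ F ⟶ Z ⟶ 0` with first map `(u, -ι)`, the map `δ` is induced by `0` on `B` and by
`F ⟶ A[1]` on `F`. (Every morphism `u : A ⟶ B` is completed to a triangle by this sequence, so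
allowing other isomorphisms in the first place would not give more triangles.) -/
def IsExactTriangle {A B C : StableCM R} (ξ : Cosyzygy A.as)
    (u : A ⟶ B) (v : B ⟶ C) (w : C ⟶ (toStable R).obj ξ.shift) : Prop :=
  ∃ (Y Z : CM R) (i : A.as ⟶ Y) (p : Y ⟶ Z) (b : Y.obj ⟶ ξ.F) (δ : Z ⟶ ξ.shift)
    (β : (toStable R).obj Y ≅ B) (γ : (toStable R).obj Z ≅ C),
    IsSES i.hom p.hom ∧
    i.hom ≫ b = -ξ.ι ∧ p.hom ≫ δ.hom = b ≫ ξ.π ∧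
    (toStable R).map i ≫ β.hom = u ∧
    (toStable R).map p ≫ γ.hom = β.hom ≫ v ∧
    (toStable R).map δ = γ.hom ≫ w

/-! ## Generation -/

/-- The full subcategory `P` of the stable category is closed under isomorphisms (this is part of
being closed under retracts), finite direct sums, direct summands, and shifts in both
directions. -/
structure IsSumSummandShiftClosed (P : ObjectProperty (StableCM R)) : Prop where
  sums : P.IsClosedUnderFiniteProducts
  summands : P.IsStableUnderRetracts
  shifts : ∀ A B : StableCM R, IsShift A B → (P A ↔ P B)

/-- `⟨𝒳⟩`: the smallest full subcategory containing `𝒳` which is closed under isomorphisms,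
shifts, finite direct sums and direct summands. -/
def gen (𝒳 : ObjectProperty (StableCM R)) : ObjectProperty (StableCM R) := fun A =>
  ∀ P : ObjectProperty (StableCM R), IsSumSummandShiftClosed P → 𝒳 ≤ P → P A

/-- `𝒳 * 𝒴`: the objects `M` in an exact triangle `X ⟶ M ⟶ Y ⟶ X[1]` with `X` in `𝒳` and
`Y` in `𝒴`. -/
def star (𝒳 𝒴 : ObjectProperty (StableCM R)) : ObjectProperty (StableCM R) := fun M =>
  ∃ (X Y : StableCM R) (ξ : Cosyzygy X.as) (u : X ⟶ M) (v : M ⟶ Y)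
    (w : Y ⟶ (toStable R).obj ξ.shift),
    𝒳 X ∧ 𝒴 Y ∧ IsExactTriangle ξ u v w

/-- `𝒳 ⋄ 𝒴 = ⟨⟨𝒳⟩ * ⟨𝒴⟩⟩`. -/
def diamond (𝒳 𝒴 : ObjectProperty (StableCM R)) : ObjectProperty (StableCM R) :=
  gen (star (gen 𝒳) (gen 𝒴))

/-- `⟨𝒳⟩₀ = 0`, `⟨𝒳⟩₁ = ⟨𝒳⟩`, and `⟨𝒳⟩ₙ = 𝒳 ⋄ ⟨𝒳⟩ₙ₋₁` for `n ≥ 2`. -/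
def genIter (𝒳 : ObjectProperty (StableCM R)) : ℕ → ObjectProperty (StableCM R)
  | 0 => fun A => Limits.IsZero A
  | 1 => gen 𝒳
  | n + 2 => diamond 𝒳 (genIter 𝒳 (n + 1))

/-- The generation time `inf {n ≥ 0 | every object is in ⟨M⟩ₙ₊₁}`, with `inf ∅ = ∞`. -/
def generationTime (M : StableCM R) : ℕ∞ :=
  sInf {t : ℕ∞ | ∃ n : ℕ, t = n ∧ genIter (fun A => A = M) (n + 1) = ⊤}

variable (R)

/-- The Orlov spectrum of the stable category of maximal Cohen-Macaulay `R`-modules: the set of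
generation times of its strong generators, i.e. of the objects of finite generation time. -/
def orlovSpectrum : Set ℕ∞ :=
  {t | ∃ M : StableCM R, generationTime M ≠ ⊤ ∧ generationTime M = t}

/-- The Rouquier dimension of the stable category of maximal Cohen-Macaulay `R`-modules: the
infimum of the Orlov spectrum, with `inf ∅ = ∞`. -/
def rouquierDim : ℕ∞ := sInf (orlovSpectrum R)

end Triangles

/-! ## Hypersurfaces -/

section Hypersurface

variable {k : Type u} [Field k]

/-- The ring `k⟦x₀, …, xₙ₋₁⟧ / (f)`. -/
abbrev Hypersurface {n : ℕ} (f : MvPowerSeries (Fin n) k) : Type u :=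
  MvPowerSeries (Fin n) k ⧸ Ideal.span {f}

/-- The power series `f + y²` in `k⟦x₀, …, xₙ₋₁, y⟧`, where `y` is the last variable. -/
def sharp {n : ℕ} (f : MvPowerSeries (Fin n) k) : MvPowerSeries (Fin (n + 1)) k :=
  MvPowerSeries.rename Fin.castSucc f + MvPowerSeries.X (Fin.last n) ^ 2

end Hypersurface

end

end StableMCM

/-! Write S = k⟦x₀,…,x_d⟧ and B = R^♯. Weierstrass division by y² + f makes B free over S on 1, y
with y² = -f (`exists_sharp_algEquiv`), so a B-module is an S-module with an endomorphism y squaring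
to -f. Since S is regular, such a module is maximal Cohen–Macaulay exactly when it is finite
projective over S (`isMCM_iff_projective`), and a finite R-module is so exactly when its first
syzygy over S is projective (`isMCM_quotient_iff`). From there on only the properties collected in
`IsDoubleCover` matter.

Knörrer's two functors connect the stable categories: the reduction N ↦ N/yN from B to R, and the
cover M ↦ Ω_B M from R to B. Both preserve short exact sequences and, up to projective summands,
projectives, so they respect sums, summands, shifts and triangles. Their composites are close to the
identity. The cover of N/yN is N ⊕ N[1], where N[1] is N with y acting as -y and the splitting
divides by 2 (`IsCover.nonempty_linearEquiv`). The reduction of the cover of M is M ⊕ ΩM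
(`IsDoubleCover.exists_coverRel_reductionRel`).

Hence every object on either side is a summand of an image, and each functor takes a generator to a
generator that needs no more steps (`IsExactCorrespondence.genIter_eq_top`). Going round the loop
from M returns M ⊕ ΩM, which lies in ⟨M⟩ and so generates no faster than M; therefore M and its
cover have the same generation time, and likewise N and its reduction. The sets of generation times
agree, and with them their infima.

The cover depends on a chosen presentation over S, so both functors are handled as relations between
modules. `IsExactCorrespondence` lists what is asked of such a relation, and its `retract` clause
makes the choices immaterial. -/

namespace StableMCM

noncomputable section

/-! ## Depth over local rings -/

section Depth

open IsLocalRing RingTheory.Sequence Abelian Pointwise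

variable {A : Type u} [CommRing A]

/-- `M` has depth at least `n`: the modules `Ext^i(N, M)`, `i < n`, vanish for all finite modules
`N` supported at the closed point. -/
def DepthGE [IsLocalRing A] (n : ℕ) (M : ModuleCat.{u} A) : Prop :=
  ∀ N : ModuleCat.{u} A, Nontrivial N → Module.Finite A N →
    Module.support A N ⊆ PrimeSpectrum.zeroLocus (maximalIdeal A) →
      ∀ i < n, Subsingleton (Ext N M i)

lemma maximalIdeal_smul_top_lt [IsLocalRing A] (M : Type u) [AddCommGroup M] [Module A M]
    [Module.Finite A M] [Nontrivial M] : maximalIdeal A • (⊤ : Submodule A M) < ⊤ :=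
  (Submodule.top_ne_ideal_smul_of_le_jacobson_annihilator
    (maximalIdeal_le_jacobson _)).symm.lt_top

lemma IsRegular.mem_maximalIdeal [IsLocalRing A] {M : Type u} [AddCommGroup M] [Module A M]
    {rs : List A} (h : IsRegular M rs) : ∀ r ∈ rs, r ∈ maximalIdeal A := by
  intro r hr
  by_contra hu
  have hu : IsUnit r := by simpa using hu
  have : Ideal.ofList rs = ⊤ := Ideal.eq_top_of_isUnit_mem _ (Ideal.subset_span hr) hu
  exact h.2 (by rw [this, Submodule.top_smul])

lemma depthGE_iff [IsLocalRing A] [IsNoetherianRing A] (n : ℕ) (M : ModuleCat.{u} A)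
    [Module.Finite A M] [Nontrivial M] :
    DepthGE n M ↔ ∃ rs : List A, rs.length = n ∧ IsRegular M rs := by
  refine ((ModuleCat.exists_isRegular_tfae (maximalIdeal A) n M
    (maximalIdeal_smul_top_lt M)).out 0 3).trans ?_
  exact ⟨fun ⟨rs, h, _, h'⟩ => ⟨rs, h, h'⟩,
    fun ⟨rs, h, h'⟩ => ⟨rs, h, IsRegular.mem_maximalIdeal h', h'⟩⟩

lemma depthGE_of_subsingleton [IsLocalRing A] (n : ℕ) (M : ModuleCat.{u} A) [Subsingleton M] :
    DepthGE n M := by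
  intro N _ _ _ i _
  refine ⟨fun a b => ?_⟩
  have hM : Limits.IsZero M := ModuleCat.isZero_of_subsingleton M
  rw [← a.comp_mk₀_id, ← b.comp_mk₀_id, hM.eq_of_src (𝟙 M) 0]
  simp

/-- From the exact piece Ext^{i-1}(N, X₃) → Ext^i(N, X₁) → Ext^i(N, X₂). A syzygy may be one deeper
than the module it resolves; this gives syzygies over S full depth. -/
lemma depthGE_left [IsLocalRing A] {n : ℕ} {T : ShortComplex (ModuleCat.{u} A)} (hT : T.ShortExact)
    (h₂ : DepthGE (n + 1) T.X₂) (h₃ : DepthGE n T.X₃) : DepthGE (n + 1) T.X₁ := by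
  intro N h h' h'' i hi
  have key : ∀ x : Ext N T.X₁ i, x = 0 := by
    intro x
    have h0 : x.comp (Ext.mk₀ T.f) (add_zero i) = 0 := by
      have := h₂ N h h' h'' i hi
      exact Subsingleton.elim _ _
    cases i with
    | zero =>
      have := hT.mono_f
      exact Ext.postcomp_mk₀_injective_of_mono N T.f (by simpa using h0)
    | succ i =>
      obtain ⟨z, rfl⟩ := Ext.covariant_sequence_exact₁ N hT x h0 rfl
      have := h₃ N h h' h'' i (by omega)
      rw [Subsingleton.elim z 0]
      simp
  exact ⟨fun a b => (key a).trans (key b).symm⟩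

lemma depthGE_right [IsLocalRing A] {n : ℕ} {T : ShortComplex (ModuleCat.{u} A)}
    (hT : T.ShortExact) (h₁ : DepthGE (n + 1) T.X₁) (h₂ : DepthGE n T.X₂) : DepthGE n T.X₃ := by
  intro N h h' h'' i hi
  have key : ∀ x : Ext N T.X₃ i, x = 0 := by
    intro x
    have := h₁ N h h' h'' (i + 1) (by omega)
    obtain ⟨z, rfl⟩ := Ext.covariant_sequence_exact₃ N hT x rfl (Subsingleton.elim _ _)
    have := h₂ N h h' h'' i hi
    rw [Subsingleton.elim z 0]
    simp
  exact ⟨fun a b => (key a).trans (key b).symm⟩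

lemma DepthGE.quotSMulTop [IsLocalRing A] {n : ℕ} {M : ModuleCat.{u} A} (h : DepthGE (n + 1) M)
    {x : A} (hx : IsSMulRegular M x) : DepthGE n (ModuleCat.of A (QuotSMulTop x M)) :=
  depthGE_right hx.smulShortComplex_shortExact h
    (fun N h₁ h₂ h₃ i hi => h N h₁ h₂ h₃ i (by omega))

/-- The bound depth M ≤ dim A/p for p ∈ Ass M. By induction: some element killed by p survives in
M/xM, where it is killed by p and x, so M/xM has an associated prime q containing p and x. As x ∉ p,
the dimension drops strictly from A/p to A/q. -/
lemma length_le_ringKrullDim_quotient_of_isRegular [IsLocalRing A] [IsNoetherianRing A]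
    (rs : List A) (M : Type u) [AddCommGroup M] [Module A M] [Module.Finite A M]
    (h : IsRegular M rs) (p : Ideal A) (hp : p ∈ associatedPrimes A M) :
    (rs.length : WithBot ℕ∞) ≤ ringKrullDim (A ⧸ p) := by
  induction rs generalizing M p with
  | nil =>
    have := hp.1
    simpa using ringKrullDim_nonneg_of_nontrivial
  | cons x rs ih =>
    have hx := IsRegular.mem_maximalIdeal h x (by simp)
    rw [isRegular_cons_iff] at h
    have hprime := hp.1
    obtain ⟨-, u, hu⟩ := hp
    let U : Submodule A M := Submodule.torsionBySet A M p
    have hp' : IsAssociatedPrime p M := ⟨hprime, u, hu⟩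
    obtain ⟨-, w, hw⟩ := isAssociatedPrime_iff.1 hp'
    have hwU : w ∈ U := by
      rw [Submodule.mem_torsionBySet_iff]
      rintro ⟨a, ha⟩
      have ha' : a ∈ p := ha
      rw [hw, Submodule.mem_colon_singleton] at ha'
      simpa using ha'
    have hw0 : w ≠ 0 := by
      rintro rfl
      exact hprime.ne_top (by rw [hw]; simp)
    have hxp : x ∉ p := by
      intro hx'
      rw [hw, Submodule.mem_colon_singleton, Submodule.mem_bot] at hx'
      exact hw0 (h.1.right_eq_zero_of_smul hx')
    -- Nakayama: if the p-torsion U were inside xM, regularity of x would give U = xU, hence U = 0.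
    obtain ⟨v, hvU, hv⟩ : ∃ v ∈ U, v ∉ x • (⊤ : Submodule A M) := by
      by_contra! hcon
      have hle : U ≤ maximalIdeal A • U := by
        intro v hv
        obtain ⟨v', -, rfl⟩ := hcon v hv
        refine Submodule.smul_mem_smul hx ?_
        rw [Submodule.mem_torsionBySet_iff] at hv ⊢
        intro a
        apply h.1
        have := hv a
        simp only [DistribSMul.toLinearMap_apply] at this
        rw [smul_comm] at this
        simpa using this
      have := Submodule.eq_bot_of_le_smul_of_le_jacobson_bot (maximalIdeal A) U
        (IsNoetherian.noetherian U) hle (maximalIdeal_le_jacobson _)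
      rw [this] at hwU
      exact hw0 (by simpa using hwU)
    let v' : QuotSMulTop x M := Submodule.Quotient.mk v
    have hv' : v' ≠ 0 := by
      intro h0
      exact hv ((Submodule.Quotient.mk_eq_zero _).1 h0)
    obtain ⟨q, hq, hle⟩ := exists_le_isAssociatedPrime_of_isNoetherianRing A v' hv'
    have h1 := ih (QuotSMulTop x M) h.2 q hq
    have hpq : p ≤ q := by
      intro a ha
      refine hle ?_
      rw [Submodule.mem_colon_singleton, Submodule.mem_bot]
      change Submodule.Quotient.mk (a • v) = 0
      rw [(Submodule.mem_torsionBySet_iff _ _).1 hvU ⟨a, ha⟩, Submodule.Quotient.mk_zero]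
    have hxq : x ∈ q := by
      refine hle ?_
      rw [Submodule.mem_colon_singleton, Submodule.mem_bot]
      change Submodule.Quotient.mk (x • v) = 0
      rw [Submodule.Quotient.mk_eq_zero]
      exact Submodule.smul_mem_pointwise_smul _ _ _ trivial
    have : ringKrullDim (A ⧸ q) + 1 ≤ ringKrullDim (A ⧸ p) := by
      refine ringKrullDim_succ_le_of_surjective (Ideal.Quotient.factor hpq)
        (Ideal.Quotient.factor_surjective hpq) (r := Ideal.Quotient.mk p x) ?_ ?_
      · exact mem_nonZeroDivisors_of_ne_zero (by rwa [Ne, Ideal.Quotient.eq_zero_iff_mem])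
      · simpa [Ideal.Quotient.eq_zero_iff_mem]
    refine le_trans ?_ this
    push_cast [List.length_cons]
    gcongr

lemma ringKrullDim_le_length [IsLocalRing A] [IsNoetherianRing A]
    (rs : List A) (hrs : ∀ r ∈ rs, r ∈ maximalIdeal A)
    (h : maximalIdeal A ≤ (Ideal.ofList rs).radical) : ringKrullDim A ≤ rs.length := by
  rw [← maximalIdeal_height_eq_ringKrullDim]
  classical
  have hmin : maximalIdeal A ∈ (Ideal.span ((rs.toFinset : Finset A) : Set A)).minimalPrimes := by
    refine ⟨⟨inferInstance, Ideal.span_le.2 fun r hr => hrs r (by simpa using hr)⟩, ?_⟩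
    rintro q ⟨hq, hsq⟩ -
    refine h.trans (hq.radical_le_iff.2 (Ideal.span_le.2 fun a ha => ?_))
    exact hsq (Ideal.subset_span (by simpa using ha))
  refine (WithBot.coe_le_coe.2 (Ideal.height_le_card_of_mem_minimalPrimes_span_finset hmin)).trans ?_
  norm_cast
  exact List.toFinset_card_le _

lemma ringKrullDim_quotient_le_length [IsLocalRing A] [IsNoetherianRing A]
    (rs : List A) (hrs : ∀ r ∈ rs, r ∈ maximalIdeal A) (p : Ideal A) [p.IsPrime]
    (h : maximalIdeal A ≤ (p ⊔ Ideal.ofList rs).radical) :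
    ringKrullDim (A ⧸ p) ≤ rs.length := by
  have : IsLocalRing (A ⧸ p) := .of_surjective' _ Ideal.Quotient.mk_surjective
  have := IsLocalHom.of_surjective (Ideal.Quotient.mk p) Ideal.Quotient.mk_surjective
  rw [← List.length_map (f := Ideal.Quotient.mk p)]
  refine ringKrullDim_le_length _ ?_ ?_
  · simp only [List.mem_map, forall_exists_index, and_imp, forall_apply_eq_imp_iff₂]
    intro a ha
    rw [mem_maximalIdeal, mem_nonunits_iff, isUnit_map_iff]
    exact hrs a ha
  · intro r hr
    obtain ⟨a, rfl⟩ := Ideal.Quotient.mk_surjective r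
    rw [mem_maximalIdeal, mem_nonunits_iff, isUnit_map_iff] at hr
    obtain ⟨n, hn⟩ := h hr
    refine ⟨n, ?_⟩
    rw [← map_pow, ← Ideal.map_ofList]
    have := Ideal.mem_map_of_mem (Ideal.Quotient.mk p) hn
    rwa [Ideal.map_sup, Ideal.map_quotient_self, bot_sup_eq] at this

/-- Parameters are regular on a module of full depth. A zero divisor a lies in some p ∈ Ass M, so
the remaining elements already cut A/p down to dimension zero; then dim A/p is smaller than the
depth, against the previous bound. The annihilator appears in the hypothesis so that it passes to
M/aM, where a has joined the annihilator. -/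
lemma isWeaklyRegular_of_depthGE [IsLocalRing A] [IsNoetherianRing A]
    (rs : List A) (hrs : ∀ r ∈ rs, r ∈ maximalIdeal A) (M : Type u) [AddCommGroup M] [Module A M]
    [Module.Finite A M] (hM : DepthGE rs.length (ModuleCat.of A M))
    (h : maximalIdeal A ≤ (Module.annihilator A M ⊔ Ideal.ofList rs).radical) :
    IsWeaklyRegular M rs := by
  induction rs generalizing M with
  | nil => simp
  | cons a as ih =>
    have ha : IsSMulRegular M a := by
      by_contra ha
      have ha' : a ∈ ⋃ p ∈ associatedPrimes A M, (p : Set A) := by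
        rw [biUnion_associatedPrimes_eq_compl_regular]
        exact ha
      obtain ⟨p, hp, hap⟩ : ∃ p ∈ associatedPrimes A M, a ∈ p := by simpa using ha'
      have hnt : Nontrivial M := by
        by_contra hn
        have := not_nontrivial_iff_subsingleton.1 hn
        exact not_isAssociatedPrime_of_subsingleton hp
      obtain ⟨rs', hlen, hreg⟩ :=
        (depthGE_iff (a :: as).length (ModuleCat.of A M)).1 hM
      have h1 : (rs'.length : WithBot ℕ∞) ≤ ringKrullDim (A ⧸ p) :=
        length_le_ringKrullDim_quotient_of_isRegular rs' M hreg p hp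
      have hprime := hp.1
      have hle : Module.annihilator A M ⊔ Ideal.ofList (a :: as) ≤ p ⊔ Ideal.ofList as := by
        have h4 : Module.annihilator A M ≤ p :=
          Submodule.annihilator_top (R := A) (M := M) ▸ IsAssociatedPrime.annihilator_le hp
        have h5 : Ideal.span {a} ≤ p := (Ideal.span_singleton_le_iff_mem _).2 hap
        rw [Ideal.ofList_cons]
        exact sup_le (h4.trans le_sup_left) (sup_le (h5.trans le_sup_left) le_sup_right)
      have h2 := ringKrullDim_quotient_le_length as
        (fun r hr => hrs r (List.mem_cons_of_mem _ hr)) p (h.trans (Ideal.radical_mono hle))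
      have h3 := h1.trans h2
      rw [hlen, List.length_cons] at h3
      have h4 : as.length + 1 ≤ as.length := by exact_mod_cast h3
      omega
    have hle : Module.annihilator A M ⊔ Ideal.ofList (a :: as) ≤
        Module.annihilator A (QuotSMulTop a M) ⊔ Ideal.ofList as := by
      have h4 : Module.annihilator A M ≤ Module.annihilator A (QuotSMulTop a M) :=
        LinearMap.annihilator_le_of_surjective (Submodule.mkQ _) (Submodule.mkQ_surjective _)
      have h5 : Ideal.span {a} ≤ Module.annihilator A (QuotSMulTop a M) := by
        rw [Ideal.span_singleton_le_iff_mem, Module.mem_annihilator]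
        intro m
        obtain ⟨m, rfl⟩ := Submodule.Quotient.mk_surjective _ m
        rw [← Submodule.Quotient.mk_smul, Submodule.Quotient.mk_eq_zero]
        exact Submodule.smul_mem_pointwise_smul _ _ _ trivial
      rw [Ideal.ofList_cons]
      exact sup_le (h4.trans le_sup_left) (sup_le (h5.trans le_sup_left) le_sup_right)
    have hM' := DepthGE.quotSMulTop (n := as.length) (M := ModuleCat.of A M) hM ha
    exact (isWeaklyRegular_cons_iff _ _ _).2 ⟨ha, ih (fun r hr => hrs r (List.mem_cons_of_mem _ hr))
      (QuotSMulTop a M) hM' (h.trans (Ideal.radical_mono hle))⟩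

/-- Regularity on M keeps 0 → K → Aⁿ → M → 0 exact on the left modulo the sequence, that is, modulo
the maximal ideal. This is the vanishing of Tor₁ with the residue field, which forces freeness over
a local ring. -/
lemma free_of_isWeaklyRegular [IsLocalRing A] [IsNoetherianRing A]
    (rs : List A) (hrs : Ideal.ofList rs = maximalIdeal A) (M : Type u) [AddCommGroup M]
    [Module A M] [Module.Finite A M] (h : IsWeaklyRegular M rs) : Module.Free A M := by
  obtain ⟨n, π, hπ⟩ := Module.Finite.exists_fin' A M
  let K := LinearMap.ker π
  refine Module.free_of_lTensor_residueField_injective K.subtype π hπ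
    (LinearMap.exact_subtype_ker_map π) ?_
  have hex := map_first_exact_on_four_term_right_exact_of_isSMulRegular_last
    (f₁ := (0 : K →ₗ[A] K)) (f₂ := K.subtype) (f₃ := π) (rs := rs) (by intro x; simp [eq_comm])
    (LinearMap.exact_subtype_ker_map π) hπ h
  rw [injective_iff_map_eq_zero]
  intro z hz
  obtain ⟨x, rfl⟩ := TensorProduct.mk_surjective A K (ResidueField A)
    Ideal.Quotient.mk_surjective z
  have h1 := (TensorProduct.quotTensorEquivQuotSMul_mk_one_tmul (maximalIdeal A) (x : Fin n → A))
  have h1' : Submodule.Quotient.mk (p := maximalIdeal A • (⊤ : Submodule A (Fin n → A)))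
      (x : Fin n → A) = 0 := by
    rw [← h1]
    exact (congrArg _ hz).trans (map_zero _)
  have h3 : (Submodule.Quotient.mk x : K ⧸ maximalIdeal A • (⊤ : Submodule A K)) = 0 := by
    rw [← hrs] at h1' ⊢
    obtain ⟨w, hw⟩ := (hex (Submodule.Quotient.mk x)).1 h1'
    rw [← hw]
    obtain ⟨w, rfl⟩ := Submodule.Quotient.mk_surjective _ w
    simp
  rw [← TensorProduct.quotTensorEquivQuotSMul_mk_one_tmul] at h3
  exact (LinearEquiv.map_eq_zero_iff _).1 h3

end Depth

/-! ## Maximal Cohen-Macaulay modules over hypersurfaces and double covers -/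

section MCM

open IsLocalRing RingTheory.Sequence

lemma isWeaklyRegular_of_projective {S : Type u} [CommRing S] {xs : List S} (hreg : IsWeaklyRegular S xs) (N : Type u)
    [AddCommGroup N] [Module S N] [Module.Projective S N] : IsWeaklyRegular N xs :=
  ((TensorProduct.lid S N).isWeaklyRegular_congr xs).1 (IsWeaklyRegular.isWeaklyRegular_rTensor (M₂ := N) hreg)

variable {S : Type u} [CommRing S] [IsLocalRing S] [IsNoetherianRing S]

lemma ringKrullDim_eq_length {xs : List S} (hxs : Ideal.ofList xs = maximalIdeal S)
    (hreg : IsRegular S xs) : ringKrullDim S = xs.length := by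
  rw [← ringKrullDim_add_length_eq_ringKrullDim_of_isRegular xs hreg, hxs]
  have : ringKrullDim (S ⧸ maximalIdeal S) = 0 :=
    ringKrullDim_eq_zero_of_isField
      ((Ideal.Quotient.maximal_ideal_iff_isField_quotient _).1 inferInstance)
  rw [this, zero_add]

lemma depthGE_of_projective {xs : List S} (hxs : Ideal.ofList xs = maximalIdeal S)
    (hreg : IsRegular S xs) (N : Type u) [AddCommGroup N] [Module S N] [Module.Finite S N]
    [Module.Projective S N] : DepthGE xs.length (ModuleCat.of S N) := by
  cases subsingleton_or_nontrivial N
  · exact depthGE_of_subsingleton _ (ModuleCat.of S N)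
  · refine (depthGE_iff _ (ModuleCat.of S N)).2 ⟨xs, rfl, ?_⟩
    refine .of_isWeaklyRegular_of_mem_maximalIdeal N (fun r hr => ?_)
      (isWeaklyRegular_of_projective hreg.1 N)
    rw [← hxs]
    exact Ideal.subset_span hr

/-- The case of the Auslander–Buchsbaum formula that is needed: over a regular local ring, full
depth leaves no room for positive projective dimension. -/
lemma projective_of_depthGE {xs : List S} (hxs : Ideal.ofList xs = maximalIdeal S)
    (N : Type u) [AddCommGroup N] [Module S N] [Module.Finite S N]
    (h : DepthGE xs.length (ModuleCat.of S N)) : Module.Projective S N := by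
  have := free_of_isWeaklyRegular xs hxs N (isWeaklyRegular_of_depthGE xs
    (fun r hr => hxs ▸ Ideal.subset_span hr) N h
    ((hxs.ge.trans le_sup_right).trans Ideal.le_radical))
  infer_instance

/-! ### Maximal Cohen–Macaulay modules over the double cover -/

section DoubleCover

variable {B : Type u} [CommRing B] [Algebra S B] [IsLocalRing B] {f : S}

/-- The parameters of S remain a system of parameters in B, and their regularity on N does not
depend on whether N is viewed over S or over B. Over S, regularity of a full set of parameters means
freeness. -/
theorem isMCM_iff_projective {xs : List S} (hxs : Ideal.ofList xs = maximalIdeal S)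
    (hreg : IsRegular S xs) (hf : f ∈ maximalIdeal S)
    (e : B ≃ₐ[S] QuadraticAlgebra S (-f) 0)
    (N : Type u) [AddCommGroup N] [Module B N] [Module S N] [IsScalarTower S B N] :
    IsMCM B (ModuleCat.of B N) ↔ Module.Finite S N ∧ Module.Projective S N := by
  have : Module.Finite S B := Module.Finite.equiv e.toLinearEquiv.symm
  have : Module.Free S B := Module.Free.of_equiv e.toLinearEquiv.symm
  have : IsNoetherianRing B := IsNoetherianRing.of_finite S B
  have hloc : IsLocalHom (algebraMap S B) := by
    refine ⟨fun a ha => ?_⟩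
    obtain ⟨b, hb⟩ := (isUnit_iff_exists_inv.1 ha)
    have h1 := congrArg e hb
    rw [map_mul, e.commutes, map_one] at h1
    have h2 := congrArg QuadraticAlgebra.re h1
    simp only [QuadraticAlgebra.re_mul, QuadraticAlgebra.algebraMap_re,
      QuadraticAlgebra.algebraMap_im, QuadraticAlgebra.re_one] at h2
    exact IsUnit.of_mul_eq_one (e b).re (by linear_combination h2)
  have hmem : ∀ r ∈ xs.map (algebraMap S B), r ∈ maximalIdeal B := by
    simp only [List.mem_map, forall_exists_index, and_imp, forall_apply_eq_imp_iff₂]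
    intro a ha
    rw [mem_maximalIdeal, mem_nonunits_iff, isUnit_map_iff, ← mem_nonunits_iff, ← mem_maximalIdeal,
      ← hxs]
    exact Ideal.subset_span ha
  -- Since B = S + Sy and y² = -f lies in the extension of the maximal ideal of S, the root y is
  -- nilpotent modulo that extension.
  have hrad : maximalIdeal B ≤ (Ideal.ofList (xs.map (algebraMap S B))).radical := by
    rw [← Ideal.map_ofList, hxs]
    let y : B := e.symm ⟨0, 1⟩
    have hy : y * y = algebraMap S B (-f) := by
      apply e.injective
      rw [map_mul, e.commutes, e.apply_symm_apply]
      ext <;> simp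
    have hb : ∀ b : B, b = algebraMap S B (e b).re + algebraMap S B (e b).im * y := by
      intro b
      apply e.injective
      rw [map_add, map_mul, e.commutes, e.commutes, e.apply_symm_apply]
      ext <;> simp
    have hyy : y * y ∈ (maximalIdeal S).map (algebraMap S B) := by
      rw [hy]
      exact Ideal.mem_map_of_mem _ (neg_mem hf)
    have hyr : y ∈ ((maximalIdeal S).map (algebraMap S B)).radical := ⟨2, by rwa [pow_two]⟩
    have hym : y ∈ maximalIdeal B := by
      have h1 : y * y ∈ maximalIdeal B := by
        refine (Ideal.map_le_iff_le_comap.2 ?_) hyy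
        intro a ha
        rw [Ideal.mem_comap, mem_maximalIdeal, mem_nonunits_iff, isUnit_map_iff]
        exact ha
      exact (or_self_iff.1 ((maximalIdeal.isMaximal B).isPrime.mem_or_mem h1))
    intro b hbm
    rw [hb b] at hbm ⊢
    refine add_mem (Ideal.le_radical (Ideal.mem_map_of_mem _ ?_)) (Ideal.mul_mem_left _ _ hyr)
    have h1 := (Ideal.add_mem_iff_left _ (Ideal.mul_mem_left _ _ hym)).1 hbm
    rw [mem_maximalIdeal, mem_nonunits_iff, isUnit_map_iff] at h1
    exact h1
  -- Krull's height theorem bounds the dimension above; the regular sequence and an associated prime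
  -- of B bound it below.
  have hdim : ringKrullDim B = xs.length := by
    have hB : IsRegular B (xs.map (algebraMap S B)) := by
      refine .of_isWeaklyRegular_of_mem_maximalIdeal B hmem ?_
      rw [isWeaklyRegular_map_algebraMap_iff]
      exact isWeaklyRegular_of_projective hreg.1 B
    refine le_antisymm ?_ ?_
    · simpa using ringKrullDim_le_length _ hmem hrad
    · obtain ⟨p, hp⟩ := associatedPrimes.nonempty B B
      have := (length_le_ringKrullDim_quotient_of_isRegular _ B hB p hp).trans
        (ringKrullDim_quotient_le p)
      simpa using this
  constructor
  · rintro ⟨hfin, hN⟩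
    have hfin' : Module.Finite B N := hfin
    have : Module.Finite S N := Module.Finite.trans B N
    refine ⟨this, ?_⟩
    obtain hN | ⟨rs, hrs, hlen⟩ := hN
    · have : Subsingleton N := hN
      infer_instance
    · have : Nontrivial N := hrs.nontrivial
      have hlen' : rs.length = (xs.map (algebraMap S B)).length := by
        rw [hdim] at hlen
        rw [List.length_map]
        exact_mod_cast hlen
      have hd := (depthGE_iff _ (ModuleCat.of B N)).2 ⟨rs, hlen', hrs⟩
      have := isWeaklyRegular_of_depthGE _ hmem N hd
        (hrad.trans (Ideal.radical_mono le_sup_right))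
      rw [isWeaklyRegular_map_algebraMap_iff] at this
      have := free_of_isWeaklyRegular xs hxs N this
      infer_instance
  · rintro ⟨hfin, hproj⟩
    have hfin' : Module.Finite B N := Module.Finite.of_restrictScalars_finite S B N
    refine ⟨hfin', ?_⟩
    cases subsingleton_or_nontrivial N with
    | inl h => exact Or.inl h
    | inr h =>
      refine Or.inr ⟨xs.map (algebraMap S B), ?_, by rw [hdim, List.length_map]⟩
      refine .of_isWeaklyRegular_of_mem_maximalIdeal N hmem ?_
      rw [isWeaklyRegular_map_algebraMap_iff]
      exact isWeaklyRegular_of_projective hreg.1 N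

end DoubleCover

/-! ### Maximal Cohen–Macaulay modules over the hypersurface -/

section Hypersurface

variable {f : S}

/-- Depth count in 0 → ker p → V → M → 0 with dim S = d + 1 = depth V (for V ≠ 0) and dim S/(f) = d:
M has depth at least d exactly when ker p has depth at least d + 1, that is, when ker p is
projective. -/
theorem isMCM_quotient_iff {xs : List S} (hxs : Ideal.ofList xs = maximalIdeal S)
    (hreg : IsRegular S xs) (hf : f ∈ maximalIdeal S) (hf₀ : f ∈ nonZeroDivisors S)
    (M : Type u) [AddCommGroup M] [Module (S ⧸ Ideal.span {f}) M] [Module S M]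
    [IsScalarTower S (S ⧸ Ideal.span {f}) M] (V : Type u) [AddCommGroup V] [Module S V]
    [Module.Finite S V] [Module.Projective S V] (p : V →ₗ[S] M) (hp : Function.Surjective p) :
    IsMCM (S ⧸ Ideal.span {f}) (ModuleCat.of (S ⧸ Ideal.span {f}) M) ↔
      Module.Projective S (LinearMap.ker p) := by
  have hnt : Ideal.span {f} ≠ ⊤ := by
    rw [Ne, Ideal.span_singleton_eq_top]
    exact hf
  have : Nontrivial (S ⧸ Ideal.span {f}) := Ideal.Quotient.nontrivial_iff.2 hnt
  have : IsLocalRing (S ⧸ Ideal.span {f}) := .of_surjective' _ Ideal.Quotient.mk_surjective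
  have hdim : ringKrullDim (S ⧸ Ideal.span {f}) + 1 = xs.length := by
    rw [← ringKrullDim_eq_length hxs hreg]
    exact ringKrullDim_quotient_span_singleton_succ_eq_ringKrullDim_of_mem_nonZeroDivisors hf₀ hf
  -- The maximal ideal contains f ≠ 0, so `xs` is not empty; the d obtained here is the dimension of
  -- S/(f).
  obtain ⟨d, hd⟩ : ∃ d, xs.length = d + 1 := by
    refine ⟨xs.length - 1, ?_⟩
    have : xs ≠ [] := by
      rintro rfl
      have : f = 0 := by simpa [← hxs] using hf
      exact (nonZeroDivisors.ne_zero hf₀) this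
    have := List.length_pos_iff.2 this
    omega
  have hdim' : ringKrullDim (S ⧸ Ideal.span {f}) = d := by
    rw [hd, Nat.cast_add, Nat.cast_one] at hdim
    revert hdim
    generalize ringKrullDim (S ⧸ Ideal.span {f}) = t
    intro h
    induction t using WithBot.recBotCoe with
    | bot => exact absurd h (by simpa using (WithBot.coe_ne_bot (a := ((d + 1 : ℕ) : ℕ∞))).symm)
    | coe t =>
      have h' : t + 1 = (d : ℕ∞) + 1 := by exact_mod_cast h
      have := ENat.add_left_injective_of_ne_top ENat.one_ne_top h'
      rw [this]
      rfl
  have hfinM : Module.Finite S M := Module.Finite.of_surjective p hp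
  have hfinM' : Module.Finite (S ⧸ Ideal.span {f}) M :=
    Module.Finite.of_restrictScalars_finite S _ M
  let T : ShortComplex (ModuleCat.{u} S) :=
    p.shortComplexKer
  have hT : T.ShortExact := LinearMap.shortExact_shortComplexKer hp
  have hV : DepthGE (d + 1) (ModuleCat.of S V) := hd ▸ depthGE_of_projective hxs hreg V
  constructor
  · rintro ⟨-, hM⟩
    refine projective_of_depthGE hxs _ ?_
    rw [hd]
    refine depthGE_left hT hV ?_
    obtain hM | ⟨rs, hrs, hlen⟩ := hM
    · have : Subsingleton (ModuleCat.of S M) := hM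
      exact depthGE_of_subsingleton _ (ModuleCat.of S M)
    · have : Nontrivial M := hrs.nontrivial
      obtain ⟨rs, rfl⟩ : ∃ rs' : List S, rs'.map (algebraMap S (S ⧸ Ideal.span {f})) = rs :=
        List.map_surjective_iff.2 Ideal.Quotient.mk_surjective rs
      refine (depthGE_iff _ (ModuleCat.of S M)).2 ⟨rs, ?_, ?_⟩
      · rw [hdim', List.length_map] at hlen
        exact_mod_cast hlen
      · have h1 := hrs.1
        rw [isWeaklyRegular_map_algebraMap_iff] at h1
        refine .of_isWeaklyRegular_of_mem_maximalIdeal M ?_ h1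
        intro r hr
        have := IsRegular.mem_maximalIdeal hrs (algebraMap S _ r) (List.mem_map_of_mem hr)
        rw [mem_maximalIdeal, mem_nonunits_iff] at this ⊢
        exact fun hu => this (hu.map _)
  · intro hK
    refine ⟨hfinM', ?_⟩
    cases subsingleton_or_nontrivial M with
    | inl h => exact Or.inl h
    | inr h =>
      have hK' : DepthGE (d + 1) (ModuleCat.of S (LinearMap.ker p)) :=
        hd ▸ depthGE_of_projective hxs hreg _
      have hM : DepthGE d (ModuleCat.of S M) := depthGE_right hT hK'
        (fun N h₁ h₂ h₃ i hi => hV N h₁ h₂ h₃ i (by omega))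
      obtain ⟨rs, hlen, hrs⟩ := (depthGE_iff _ (ModuleCat.of S M)).1 hM
      refine Or.inr ⟨rs.map (algebraMap S (S ⧸ Ideal.span {f})), ?_, ?_⟩
      · refine .of_isWeaklyRegular_of_mem_maximalIdeal M ?_ ?_
        · simp only [List.mem_map, forall_exists_index, and_imp, forall_apply_eq_imp_iff₂]
          intro a ha
          have := IsRegular.mem_maximalIdeal hrs a ha
          have := IsLocalHom.of_surjective (algebraMap S (S ⧸ Ideal.span {f}))
            Ideal.Quotient.mk_surjective
          rw [mem_maximalIdeal, mem_nonunits_iff, isUnit_map_iff]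
          assumption
        · rw [isWeaklyRegular_map_algebraMap_iff]
          exact hrs.1
      · rw [hdim', List.length_map, hlen]

end Hypersurface

end MCM

/-! ## Power series rings and the double branched cover -/

section PowerSeries

open IsLocalRing RingTheory.Sequence MvPowerSeries

/-! ### Weierstrass division by y² + f -/

section

variable {σ : Type*} {k : Type*} [CommRing k] {f : MvPowerSeries σ k}

/-- Multiplication by a series without constant term raises the order by at least one. This replaces
any appeal to topology in the convergence arguments that follow. -/
lemma coeff_mul_eq_zero_of_degree_le (hf : constantCoeff f = 0) {q : MvPowerSeries σ k} {n : ℕ}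
    (hq : ∀ x : σ →₀ ℕ, x.degree < n → coeff x q = 0) (x : σ →₀ ℕ) (hx : x.degree ≤ n) :
    coeff x (f * q) = 0 := by
  classical
  rw [coeff_mul]
  refine Finset.sum_eq_zero fun ⟨a, b⟩ hab => ?_
  have hab' : a + b = x := by simpa using hab
  by_cases ha : a = 0
  · subst ha
    simp only [coeff_zero_eq_constantCoeff_apply, hf, zero_mul]
  · have h1 : a.degree + b.degree = x.degree := by rw [← hab', map_add]
    have h2 : a.degree ≠ 0 := by rwa [Ne, Finsupp.degree_eq_zero_iff]
    simp only
    rw [hq b (by omega), mul_zero]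

/-- Solving `s n = c n + f * s (n + 1)` by `s n = ∑ j, f ^ j * c (n + j)`. -/
lemma exists_eq_add_mul_succ (hf : constantCoeff f = 0) (c : ℕ → MvPowerSeries σ k) :
    ∃ s : ℕ → MvPowerSeries σ k, ∀ n, s n = c n + f * s (n + 1) := by
  let t : ℕ → ℕ → MvPowerSeries σ k := fun N n => ∑ j ∈ Finset.range N, f ^ j * c (n + j)
  have ht : ∀ N n, t (N + 1) n = c n + f * t N (n + 1) := by
    intro N n
    simp only [t, Finset.sum_range_succ', Finset.mul_sum]
    rw [add_comm]
    congr 1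
    · simp
    · refine Finset.sum_congr rfl fun j _ => ?_
      rw [pow_succ', mul_assoc, show n + (j + 1) = n + 1 + j by ring]
  -- The new term of the partial sum is divisible by f^N, so coefficients of degree below N no
  -- longer change; the limit is read off coefficient by coefficient.
  have hstep : ∀ N n (x : σ →₀ ℕ), x.degree < N → coeff x (t (N + 1) n) = coeff x (t N n) := by
    intro N
    induction N with
    | zero => intro n x hx; omega
    | succ N ih =>
      intro n x hx
      rw [ht (N + 1) n, ht N n, ← sub_eq_zero, ← map_sub, add_sub_add_left_eq_sub, ← mul_sub]
      refine coeff_mul_eq_zero_of_degree_le hf (n := N) (fun y hy => ?_) x (by omega)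
      rw [map_sub, ih _ _ hy, sub_self]
  have hstable : ∀ N n (x : σ →₀ ℕ), x.degree < N →
      coeff x (t N n) = coeff x (t (x.degree + 1) n) := by
    intro N n x hx
    induction N, hx using Nat.le_induction with
    | base => rfl
    | succ N hN ih => rw [hstep N n x hN, ih]
  let s : ℕ → MvPowerSeries σ k := fun n x => coeff x (t (x.degree + 1) n)
  have hs : ∀ n (x : σ →₀ ℕ), coeff x (s n) = coeff x (t (x.degree + 1) n) := fun n x => rfl
  refine ⟨s, fun n => ?_⟩
  ext x
  rw [hs, ← hstable (x.degree + 1 + 1) n x (by omega), ht, map_add, map_add, add_right_inj,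
    ← sub_eq_zero, ← map_sub, ← mul_sub]
  refine coeff_mul_eq_zero_of_degree_le hf (n := x.degree + 1) (fun y hy => ?_) x (by omega)
  rw [map_sub, hs, hstable _ _ _ hy, sub_self]

/-- Each term is divisible by every power of f, hence has infinite order. -/
lemma eq_zero_of_eq_mul_succ (hf : constantCoeff f = 0) (s : ℕ → MvPowerSeries σ k)
    (hs : ∀ n, s n = f * s (n + 1)) (n : ℕ) : s n = 0 := by
  have key : ∀ N n (x : σ →₀ ℕ), x.degree < N → coeff x (s n) = 0 := by
    intro N
    induction N with
    | zero => intro n x hx; omega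
    | succ N ih =>
      intro n x hx
      rw [hs n]
      exact coeff_mul_eq_zero_of_degree_le hf (ih (n + 1)) x (by omega)
  ext x
  exact key _ n x (Nat.lt_succ_self _)

/-- Weierstrass division by `X ^ 2 + f`. -/
lemma exists_division_X_sq_add (hf : constantCoeff f = 0) (g : PowerSeries (MvPowerSeries σ k)) :
    ∃ (q : PowerSeries (MvPowerSeries σ k)) (a b : MvPowerSeries σ k),
      g = (PowerSeries.X ^ 2 + PowerSeries.C f) * q + (PowerSeries.C a + PowerSeries.C b *
        PowerSeries.X) := by
  have hf' : constantCoeff (-f) = 0 := by rw [map_neg, hf, neg_zero]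
  -- Comparing coefficients of degree i + 2 asks for q_i = g_{i+2} - f q_{i+2}. The recursion has
  -- step two, so `s₀` and `s₁` solve for the even and odd coefficients of q separately.
  obtain ⟨s₀, hs₀⟩ := exists_eq_add_mul_succ hf' (fun n => PowerSeries.coeff (2 * n + 2) g)
  obtain ⟨s₁, hs₁⟩ := exists_eq_add_mul_succ hf' (fun n => PowerSeries.coeff (2 * n + 3) g)
  let q : PowerSeries (MvPowerSeries σ k) :=
    PowerSeries.mk fun i => if Even i then s₀ (i / 2) else s₁ (i / 2)
  have hq : ∀ i, PowerSeries.coeff (i + 2) g =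
      PowerSeries.coeff i q + f * PowerSeries.coeff (i + 2) q := by
    intro i
    simp only [q, PowerSeries.coeff_mk]
    obtain ⟨j, rfl | rfl⟩ := Nat.even_or_odd' i
    · have h1 : 2 * j / 2 = j := by omega
      have h2 : (2 * j + 2) / 2 = j + 1 := by omega
      have h3 : Even (2 * j) := even_two_mul j
      have h4 : Even (2 * j + 2) := by simp [parity_simps]
      rw [if_pos h3, if_pos h4, h1, h2]
      linear_combination -(hs₀ j)
    · have h1 : (2 * j + 1) / 2 = j := by omega
      have h2 : (2 * j + 1 + 2) / 2 = j + 1 := by omega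
      have h3 : ¬ Even (2 * j + 1) := by simp [parity_simps]
      have h4 : ¬ Even (2 * j + 1 + 2) := by simp [parity_simps]
      rw [if_neg h3, if_neg h4, h1, h2]
      linear_combination -(hs₁ j)
  refine ⟨q, PowerSeries.coeff 0 g - f * PowerSeries.coeff 0 q,
    PowerSeries.coeff 1 g - f * PowerSeries.coeff 1 q, ?_⟩
  ext1 i
  rw [add_mul, map_add, map_add, map_add, PowerSeries.coeff_C_mul, PowerSeries.coeff_C_mul,
    PowerSeries.coeff_C, PowerSeries.coeff_X, PowerSeries.coeff_X_pow_mul']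
  match i with
  | 0 => simp
  | 1 => simp
  | i + 2 => simp [hq i]

/-- Uniqueness of the remainder in the division by `X ^ 2 + f`. -/
lemma division_X_sq_add_unique (hf : constantCoeff f = 0) (q : PowerSeries (MvPowerSeries σ k))
    (a b : MvPowerSeries σ k) (h : (PowerSeries.X ^ 2 + PowerSeries.C f) * q =
      PowerSeries.C a + PowerSeries.C b * PowerSeries.X) : a = 0 ∧ b = 0 := by
  have hf' : constantCoeff (-f) = 0 := by rw [map_neg, hf, neg_zero]
  have hc : ∀ i, PowerSeries.coeff i ((PowerSeries.X ^ 2 + PowerSeries.C f) * q) =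
      PowerSeries.coeff i (PowerSeries.C a + PowerSeries.C b * PowerSeries.X) := by
    intro i; rw [h]
  simp only [add_mul, map_add, PowerSeries.coeff_C_mul, PowerSeries.coeff_C, PowerSeries.coeff_X,
    PowerSeries.coeff_X_pow_mul'] at hc
  have hq : ∀ i, PowerSeries.coeff i q = -f * PowerSeries.coeff (i + 2) q := by
    intro i
    have := hc (i + 2)
    simp at this
    linear_combination this
  have h0 := eq_zero_of_eq_mul_succ hf' (fun n => PowerSeries.coeff (2 * n) q)
    (fun n => hq (2 * n)) 0
  have h1 := eq_zero_of_eq_mul_succ hf' (fun n => PowerSeries.coeff (2 * n + 1) q)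
    (fun n => hq (2 * n + 1)) 0
  have e0 := hc 0
  have e1 := hc 1
  simp at h0 h1 e0 e1
  constructor
  · rw [← e0, h0, mul_zero]
  · rw [← e1, h1, mul_zero]

end

/-! ### The double branched cover as a quadratic algebra -/

section

variable {n : ℕ} {k : Type u} [Field k]

/-- Power series in `n + 1` variables as power series in the last variable. -/
def lastEquiv (n : ℕ) (k : Type u) [Field k] :
    MvPowerSeries (Fin (n + 1)) k ≃ₐ[k] PowerSeries (MvPowerSeries (Fin n) k) :=
  (renameEquiv k finSuccEquivLast).trans (optionEquivLeft (Fin n) k)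

lemma lastEquiv_X_last : lastEquiv n k (X (Fin.last n)) = PowerSeries.X := by
  simp [lastEquiv]

lemma lastEquiv_rename (s : MvPowerSeries (Fin n) k) :
    lastEquiv n k (rename Fin.castSucc s) = PowerSeries.C s := by
  have h0 : ∀ (g : Fin n → Option (Fin n)) [Filter.TendstoCofinite g],
      g = Function.Embedding.some → rename (R := k) g s =
        rename (Function.Embedding.some : Fin n ↪ Option (Fin n)) s := by
    rintro _ _ rfl; rfl
  have h1 : (renameEquiv k finSuccEquivLast) (rename Fin.castSucc s) =
      rename (Function.Embedding.some : Fin n ↪ Option (Fin n)) s := by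
    refine (rename_rename (f := Fin.castSucc) (g := finSuccEquivLast) s).trans ?_
    exact h0 _ (by ext1 i; simp)
  rw [lastEquiv, AlgEquiv.trans_apply, h1]
  ext i x
  rw [coeff_coeff_optionEquivLeft, PowerSeries.coeff_C]
  split_ifs with hi
  · subst hi
    rw [← coeff_embDomain_rename Function.Embedding.some s x]
    congr 1
    congr 1
    ext j
    cases j with
    | none =>
      rw [Finsupp.embDomain_of_notMem_range _ _ _ (by simp)]
      simp
    | some j =>
      simp
  · rw [coeff_rename_eq_zero, map_zero]
    rintro ⟨z, hz⟩
    have := congrArg (fun w => w none) hz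
    simp only [Finsupp.optionElim_apply_none] at this
    rw [Finsupp.mapDomain_of_notMem_range _ _ (by simp)] at this
    exact hi this.symm

lemma lastEquiv_sharp (f : MvPowerSeries (Fin n) k) :
    lastEquiv n k (sharp f) = PowerSeries.X ^ 2 + PowerSeries.C f := by
  rw [sharp, map_add, map_pow, lastEquiv_rename, lastEquiv_X_last, add_comm]

/-- The `k⟦x₀, …, xₙ₋₁⟧`-algebra structure on the double branched cover. -/
@[reducible]
def sharpAlgebra (f : MvPowerSeries (Fin n) k) :
    Algebra (MvPowerSeries (Fin n) k) (Hypersurface (sharp f)) :=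
  ((Ideal.Quotient.mk (Ideal.span {sharp f})).comp
    (rename (R := k) (Fin.castSucc (n := n))).toRingHom).toAlgebra

attribute [local instance] sharpAlgebra

lemma sharp_algebraMap (f s : MvPowerSeries (Fin n) k) :
    algebraMap (MvPowerSeries (Fin n) k) (Hypersurface (sharp f)) s =
      Ideal.Quotient.mk _ (rename Fin.castSucc s) := rfl

/-- The double branched cover `k⟦x, y⟧ / (f + y²)` is free with basis `1, y` over `k⟦x⟧`. -/
theorem exists_sharp_algEquiv (f : MvPowerSeries (Fin n) k) (hf : constantCoeff f = 0) :
    Nonempty (Hypersurface (sharp f) ≃ₐ[MvPowerSeries (Fin n) k]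
      QuadraticAlgebra (MvPowerSeries (Fin n) k) (-f) 0) := by
  let y : Hypersurface (sharp f) := Ideal.Quotient.mk _ (X (Fin.last n))
  have hy : y * y = (-f) • (1 : Hypersurface (sharp f)) + (0 : MvPowerSeries (Fin n) k) • y := by
    rw [Algebra.smul_def, Algebra.smul_def, map_zero, zero_mul, add_zero, mul_one, sharp_algebraMap, ← map_mul,
      Ideal.Quotient.mk_eq_mk_iff_sub_mem, Ideal.mem_span_singleton, sharp]
    rw [map_neg, sub_neg_eq_add, ← pow_two]
    exact (add_comm _ _).dvd
  let φ : QuadraticAlgebra (MvPowerSeries (Fin n) k) (-f) 0 →ₐ[MvPowerSeries (Fin n) k]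
    Hypersurface (sharp f) := QuadraticAlgebra.lift ⟨y, hy⟩
  have hφ : ∀ z, φ z = Ideal.Quotient.mk _
      (rename Fin.castSucc z.re + rename Fin.castSucc z.im * X (Fin.last n)) := by
    intro z
    simp only [φ, QuadraticAlgebra.lift_apply_apply, Algebra.smul_def, mul_one, map_add, map_mul,
      sharp_algebraMap, y]
  -- Once the ideal is rewritten as the multiples of X² + f, injectivity of `φ` is uniqueness of the
  -- remainder and surjectivity is its existence.
  have hmem : ∀ p : MvPowerSeries (Fin (n + 1)) k,
      (Ideal.Quotient.mk (Ideal.span {sharp f})) p = 0 ↔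
        ∃ q, (PowerSeries.X ^ 2 + PowerSeries.C f) * q = lastEquiv n k p := by
    intro p
    rw [Ideal.Quotient.eq_zero_iff_mem, Ideal.mem_span_singleton, ← lastEquiv_sharp]
    constructor
    · rintro ⟨q, rfl⟩
      exact ⟨lastEquiv n k q, (map_mul _ _ _).symm⟩
    · rintro ⟨q, hq⟩
      refine ⟨(lastEquiv n k).symm q, (lastEquiv n k).injective ?_⟩
      rw [map_mul, AlgEquiv.apply_symm_apply, hq]
  refine ⟨(AlgEquiv.ofBijective φ ⟨?_, ?_⟩).symm⟩
  · rw [injective_iff_map_eq_zero]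
    intro z hz
    rw [hφ, hmem] at hz
    obtain ⟨q, hq⟩ := hz
    rw [map_add, map_mul, lastEquiv_rename, lastEquiv_rename, lastEquiv_X_last] at hq
    obtain ⟨h1, h2⟩ := division_X_sq_add_unique hf _ _ _ hq
    ext1 <;> assumption
  · intro b
    obtain ⟨p, rfl⟩ := Ideal.Quotient.mk_surjective b
    obtain ⟨q, r, s, h⟩ := exists_division_X_sq_add hf (lastEquiv n k p)
    refine ⟨⟨r, s⟩, ?_⟩
    rw [hφ, ← sub_eq_zero, ← map_sub, hmem]
    refine ⟨-q, ?_⟩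
    rw [map_sub, map_add, map_mul, lastEquiv_rename, lastEquiv_rename, lastEquiv_X_last, h]
    ring

end

/-! ### The variables form a regular sequence generating the maximal ideal -/

section Regular

variable {A A' : Type u} [CommRing A] [CommRing A'] (φ : A →+* A') (hφ : Function.Surjective φ)
  {a : A} (ha : RingHom.ker φ = Ideal.span {a}) {rs : List A}

include hφ ha

/-- A/aA and A' are identified only as additive groups compatible with the action of the sequence,
which is all that regularity sees. -/
lemma isWeaklyRegular_cons_of_surjective (haₙ : IsSMulRegular A a)
    (hrs : IsWeaklyRegular A' (rs.map φ)) : IsWeaklyRegular A (a :: rs) := by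
  rw [isWeaklyRegular_cons_iff]
  refine ⟨haₙ, ?_⟩
  let ψ : QuotSMulTop a A →+ A' := QuotientAddGroup.lift _ φ.toAddMonoidHom (by
    intro x hx
    obtain ⟨c, -, rfl⟩ := (Submodule.mem_smul_pointwise_iff_exists _ _ _).1 hx
    have : φ a = 0 := by
      rw [← RingHom.mem_ker, ha]
      exact Ideal.mem_span_singleton_self a
    change φ (a * c) = 0
    rw [map_mul, this, zero_mul])
  have hψ' : ∀ x : A, ψ (Submodule.Quotient.mk x) = φ x := fun x => rfl
  have hψ : Function.Bijective ψ := by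
    refine ⟨?_, fun z => ?_⟩
    · rw [injective_iff_map_eq_zero]
      intro x hx
      obtain ⟨x, rfl⟩ := Submodule.Quotient.mk_surjective _ x
      rw [hψ', ← RingHom.mem_ker, ha, Ideal.mem_span_singleton] at hx
      obtain ⟨c, rfl⟩ := hx
      rw [Submodule.Quotient.mk_eq_zero]
      exact Submodule.smul_mem_pointwise_smul c a _ trivial
    · obtain ⟨x, rfl⟩ := hφ z
      exact ⟨Submodule.Quotient.mk x, rfl⟩
  refine ((AddEquiv.ofBijective ψ hψ).isWeaklyRegular_congr (bs := rs.map φ) ?_).2 hrs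
  refine List.forall₂_map_right_iff.2 (List.forall₂_same.2 fun r _ x => ?_)
  obtain ⟨x, rfl⟩ := Submodule.Quotient.mk_surjective _ x
  exact map_mul φ r x

lemma ofList_cons_eq_maximalIdeal [IsLocalRing A] [IsLocalRing A']
    (hrs : Ideal.ofList (rs.map φ) = maximalIdeal A') :
    Ideal.ofList (a :: rs) = maximalIdeal A := by
  have := IsLocalHom.of_surjective φ hφ
  have h1 : (maximalIdeal A').comap φ = maximalIdeal A := ((IsLocalRing.local_hom_TFAE φ).out 0 4).1 this
  rw [← h1, ← hrs, ← Ideal.map_ofList, Ideal.comap_map_of_surjective φ hφ, Ideal.ofList_cons,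
    ← RingHom.ker_eq_comap_bot, ha, sup_comm]

end Regular

section

variable {k : Type u} [Field k]

/-- Induction by setting the first variable to zero; that map has kernel generated by `X 0`. With no
variables the ring is a field and its maximal ideal is zero. -/
lemma isWeaklyRegular_X (n : ℕ) :
    IsWeaklyRegular (MvPowerSeries (Fin n) k)
      ((List.finRange n).map (X (R := k))) ∧
      Ideal.ofList ((List.finRange n).map (X (R := k))) =
        maximalIdeal (MvPowerSeries (Fin n) k) := by
  induction n with
  | zero =>
    refine ⟨by simp, ?_⟩
    rw [List.finRange_zero, List.map_nil, Ideal.ofList_nil, eq_comm, eq_bot_iff]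
    intro p hp
    rw [mem_maximalIdeal, mem_nonunits_iff, isUnit_iff_constantCoeff, isUnit_iff_ne_zero,
      not_not] at hp
    rw [Ideal.mem_bot]
    ext x
    rw [Subsingleton.elim x 0, coeff_zero_eq_constantCoeff_apply, hp, map_zero]
  | succ n ih =>
    let φ : MvPowerSeries (Fin (n + 1)) k →+* MvPowerSeries (Fin n) k :=
      PowerSeries.constantCoeff.comp (finSuccEquiv k n : _ →+* _)
    have hφ' : ∀ p, φ p = PowerSeries.constantCoeff (finSuccEquiv k n p) := fun _ => rfl
    have hφ : Function.Surjective φ := fun z =>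
      ⟨(finSuccEquiv k n).symm (PowerSeries.C z), by simp [hφ']⟩
    have hker : RingHom.ker φ = Ideal.span {X 0} := by
      ext p
      rw [RingHom.mem_ker, hφ', ← PowerSeries.X_dvd_iff, Ideal.mem_span_singleton,
        ← finSuccEquiv_X_zero]
      exact map_dvd_iff (finSuccEquiv k n)
    have hmap : ((List.finRange n).map (X (R := k) ∘ Fin.succ)).map φ =
        (List.finRange n).map X := by
      rw [List.map_map]
      refine List.map_congr_left fun i _ => ?_
      simp [hφ']
    rw [List.finRange_succ, List.map_cons, List.map_map]
    refine ⟨isWeaklyRegular_cons_of_surjective φ hφ hker ?_ (hmap ▸ ih.1),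
      ofList_cons_eq_maximalIdeal φ hφ hker (hmap ▸ ih.2)⟩
    have h0 : (X 0 : MvPowerSeries (Fin (n + 1)) k) ≠ 0 := by
      intro h
      have := congrArg (finSuccEquiv k n) h
      rw [finSuccEquiv_X_zero, map_zero] at this
      exact PowerSeries.X_ne_zero this
    exact (IsRegular.of_ne_zero h0).left.isSMulRegular

lemma isRegular_X (n : ℕ) :
    RingTheory.Sequence.IsRegular (MvPowerSeries (Fin n) k)
      ((List.finRange n).map (X (R := k))) :=
  .of_isWeaklyRegular_of_mem_maximalIdeal _
    (fun _ hr => (isWeaklyRegular_X (k := k) n).2 ▸ Ideal.subset_span hr)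
    (isWeaklyRegular_X (k := k) n).1

end

end PowerSeries

/-! ## Generation in the stable category -/

section Generation

open Limits

variable {A : Type u} [CommRing A]

/-- The linear map `f` factors through a finitely generated projective module. -/
def FactorsThroughProjective {M N : Type u} [AddCommGroup M] [Module A M] [AddCommGroup N]
    [Module A N] (f : M →ₗ[A] N) : Prop :=
  ∃ (P : Type u) (_ : AddCommGroup P) (_ : Module A P) (a : M →ₗ[A] P) (b : P →ₗ[A] N),
    Module.Finite A P ∧ Module.Projective A P ∧ f = b ∘ₗ a

/-- A morphism in `CM(A)` from a linear map. -/
abbrev homOf {X Y : CM A} (f : X.obj →ₗ[A] Y.obj) : X ⟶ Y :=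
  ObjectProperty.homMk (ModuleCat.ofHom f)

/-- The object of `CM(A)` given by a maximal Cohen-Macaulay module. -/
abbrev cmOf (M : Type u) [AddCommGroup M] [Module A M] (h : IsMCM A (ModuleCat.of A M)) : CM A :=
  ⟨ModuleCat.of A M, h⟩

/-- The object of the stable category given by a maximal Cohen-Macaulay module. -/
abbrev stab (X : CM A) : StableCM A := (toStable A).obj X

lemma map_eq_map_iff {X Y : CM A} (f g : X ⟶ Y) :
    (toStable A).map f = (toStable A).map g ↔
      FactorsThroughProjective (f.hom.hom - g.hom.hom) := by
  rw [Quotient.functor_map_eq_iff]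
  constructor
  · rintro ⟨P, a, b, h₁, h₂, h⟩
    exact ⟨P, _, _, a.hom, b.hom, h₁, h₂, by simpa using congrArg ModuleCat.Hom.hom h⟩
  · rintro ⟨P, _, _, a, b, h₁, h₂, h⟩
    exact ⟨ModuleCat.of A P, ModuleCat.ofHom a, ModuleCat.ofHom b, h₁, h₂,
      ModuleCat.hom_ext (by simpa using h)⟩

lemma factorsThroughProjective_zero {M N : Type u} [AddCommGroup M] [Module A M] [AddCommGroup N]
    [Module A N] : FactorsThroughProjective (0 : M →ₗ[A] N) :=
  ⟨PUnit, inferInstance, inferInstance, 0, 0, inferInstance, inferInstance, by simp⟩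

/-- `M` is a direct summand of `N` in the stable category. -/
def StableSummand (M N : Type u) [AddCommGroup M] [Module A M] [AddCommGroup N]
    [Module A N] : Prop :=
  ∃ (i : M →ₗ[A] N) (r : N →ₗ[A] M), FactorsThroughProjective (LinearMap.id - r ∘ₗ i)

lemma StableSummand.of_leftInverse {M N : Type u} [AddCommGroup M] [Module A M] [AddCommGroup N]
    [Module A N] (i : M →ₗ[A] N) (r : N →ₗ[A] M) (h : ∀ x, r (i x) = x) :
    StableSummand (A := A) M N :=
  ⟨i, r, by
    have : LinearMap.id - r ∘ₗ i = 0 := by ext x; simp [h]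
    rw [this]; exact factorsThroughProjective_zero⟩

lemma nonempty_retract_iff {X Y : CM A} :
    Nonempty (Retract (stab X) (stab Y)) ↔ StableSummand (A := A) X.obj Y.obj := by
  constructor
  · rintro ⟨i, r, h⟩
    obtain ⟨i, rfl⟩ := (toStable A).map_surjective i
    obtain ⟨r, rfl⟩ := (toStable A).map_surjective r
    rw [← Functor.map_comp, ← (toStable A).map_id] at h
    exact ⟨i.hom.hom, r.hom.hom, by simpa using (map_eq_map_iff _ _).1 h.symm⟩
  · rintro ⟨i, r, h⟩
    refine ⟨⟨(toStable A).map (homOf i), (toStable A).map (homOf r), ?_⟩⟩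
    rw [← Functor.map_comp, ← (toStable A).map_id]
    refine ((map_eq_map_iff _ _).2 ?_).symm
    simpa using h

lemma prop_of_stableSummand {P : ObjectProperty (StableCM A)} [P.IsStableUnderRetracts]
    {X Y : CM A} (h : StableSummand (A := A) X.obj Y.obj) (hY : P (stab Y)) : P (stab X) :=
  P.prop_of_retract (nonempty_retract_iff.2 h).some hY

lemma isSES_iff {X Y Z : CM A} (i : X ⟶ Y) (p : Y ⟶ Z) :
    IsSES i.hom p.hom ↔ Function.Injective i.hom.hom ∧ Function.Surjective p.hom.hom ∧
      Function.Exact i.hom.hom p.hom.hom := by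
  constructor
  · rintro ⟨w, h⟩
    exact ⟨h.moduleCat_injective_f, h.moduleCat_surjective_g,
      (ShortComplex.ShortExact.moduleCat_exact_iff_function_exact _).1 h.exact⟩
  · rintro ⟨hi, hp, h⟩
    exact ⟨ModuleCat.hom_ext h.linearMap_comp_eq_zero,
      ModuleCat.shortComplex_shortExact _ h hi hp⟩

/-- A cosyzygy sequence from an exact sequence of modules. -/
abbrev Cosyzygy.of {X Z : CM A} {F : Type u} [AddCommGroup F] [Module A F]
    (hF : Module.Finite A F) (hF' : Module.Projective A F) (i : X.obj →ₗ[A] F) (p : F →ₗ[A] Z.obj)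
    (hi : Function.Injective i) (hp : Function.Surjective p) (h : Function.Exact i p) :
    Cosyzygy X where
  F := ModuleCat.of A F
  finite := hF
  projective := hF'
  shift := Z
  ι := ModuleCat.ofHom i
  π := ModuleCat.ofHom p
  ses := ⟨ModuleCat.hom_ext h.linearMap_comp_eq_zero,
      ModuleCat.shortComplex_shortExact _ h hi hp⟩

lemma Cosyzygy.exact {X : CM A} (ξ : Cosyzygy X) :
    Function.Injective ξ.ι.hom ∧ Function.Surjective ξ.π.hom ∧
      Function.Exact ξ.ι.hom ξ.π.hom := by
  obtain ⟨w, h⟩ := ξ.ses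
  exact ⟨h.moduleCat_injective_f, h.moduleCat_surjective_g,
    (ShortComplex.ShortExact.moduleCat_exact_iff_function_exact _).1 h.exact⟩

/-- The extension `b` of the inclusion into the cosyzygy sequence is an input because its existence
is a form of injectivity of projectives among maximal Cohen–Macaulay modules.
`IsDoubleCover.exists_cosyzygy_extension` supplies it over the double cover, and reduction carries
it to the hypersurface. -/
lemma star_of_exact {X Y Z : CM A} (i : X.obj →ₗ[A] Y.obj) (p : Y.obj →ₗ[A] Z.obj)
    (hi : Function.Injective i) (hp : Function.Surjective p) (h : Function.Exact i p)
    (ξ : Cosyzygy X) (b : Y.obj →ₗ[A] ξ.F) (hb : ∀ x, b (i x) = ξ.ι.hom x)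
    {𝒳 𝒴 : ObjectProperty (StableCM A)} (hX : 𝒳 (stab X)) (hZ : 𝒴 (stab Z)) :
    star 𝒳 𝒴 (stab Y) := by
  have hs : IsSES (homOf i).hom (homOf p).hom := (isSES_iff _ _).2 ⟨hi, hp, h⟩
  have hs' := hs
  obtain ⟨w, hw⟩ := hs'
  have := hw.epi_g
  -- The sign convention of `IsExactTriangle` asks for an extension of -ι, hence -b.
  have hz : ModuleCat.ofHom i ≫ (-ModuleCat.ofHom b ≫ ξ.π) = 0 := by
    ext x
    have := (ξ.exact.2.2 (ξ.ι.hom x)).2 ⟨x, rfl⟩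
    simp [hb, this]
  let δ : Z ⟶ ξ.shift := ObjectProperty.homMk (hw.exact.desc _ hz)
  refine ⟨stab X, stab Z, ξ, (toStable A).map (homOf i), (toStable A).map (homOf p),
    (toStable A).map δ, hX, hZ, Y, Z, homOf i, homOf p, -ModuleCat.ofHom b, δ, Iso.refl _,
    Iso.refl _, hs, ?_, ?_, by simp, by simp, by simp⟩
  · ext x
    simp [hb]
  · exact (hw.exact.g_desc _ hz).trans (by simp)

/-- Only the short exact sequence is kept from a triangle: the connecting morphism is rebuilt after
transport to the other ring. -/
lemma star.exists_exact {𝒳 𝒴 : ObjectProperty (StableCM A)} {M : StableCM A} (h : star 𝒳 𝒴 M) :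
    ∃ (X Y Z : CM A) (i : X.obj →ₗ[A] Y.obj) (p : Y.obj →ₗ[A] Z.obj),
      Function.Injective i ∧ Function.Surjective p ∧ Function.Exact i p ∧ 𝒳 (stab X) ∧
      Nonempty (stab Y ≅ M) ∧ ∃ W, 𝒴 W ∧ Nonempty (stab Z ≅ W) := by
  obtain ⟨X, W, ξ, u, v, w, hX, hW, Y, Z, i, p, b, δ, β, γ, hs, -⟩ := h
  obtain ⟨hi, hp, he⟩ := (isSES_iff _ _).1 hs
  exact ⟨X.as, Y, Z, i.hom.hom, p.hom.hom, hi, hp, he, hX, ⟨β⟩, W, hW, ⟨γ⟩⟩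

lemma star_mono {𝒳 𝒳' 𝒴 𝒴' : ObjectProperty (StableCM A)} (h : 𝒳 ≤ 𝒳') (h' : 𝒴 ≤ 𝒴') :
    star 𝒳 𝒴 ≤ star 𝒳' 𝒴' := by
  rintro M ⟨X, Y, ξ, u, v, w, hX, hY, H⟩
  exact ⟨X, Y, ξ, u, v, w, h _ hX, h' _ hY, H⟩

lemma le_gen (𝒳 : ObjectProperty (StableCM A)) : 𝒳 ≤ gen 𝒳 := fun _ hX _ _ hP => hP _ hX

lemma gen_le {𝒳 P : ObjectProperty (StableCM A)} (hP : IsSumSummandShiftClosed P) (h : 𝒳 ≤ P) :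
    gen 𝒳 ≤ P := fun _ hX => hX P hP h

lemma isSumSummandShiftClosed_gen (𝒳 : ObjectProperty (StableCM A)) :
    IsSumSummandShiftClosed (gen 𝒳) where
  sums := ⟨fun J _ => ⟨fun X ⟨h⟩ P hP hX => by
    have := hP.sums
    exact (h.ofLE fun Y hY => hY P hP hX).prop⟩⟩
  summands := ⟨fun r hY P hP hX => by
    have := hP.summands
    exact P.prop_of_retract r (hY P hP hX)⟩
  shifts X Y h := ⟨fun hX P hP h𝒳 => (hP.shifts X Y h).1 (hX P hP h𝒳),
    fun hY P hP h𝒳 => (hP.shifts X Y h).2 (hY P hP h𝒳)⟩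

lemma gen_mono {𝒳 𝒴 : ObjectProperty (StableCM A)} (h : 𝒳 ≤ gen 𝒴) : gen 𝒳 ≤ gen 𝒴 :=
  gen_le (isSumSummandShiftClosed_gen _) h

lemma isSumSummandShiftClosed_genIter (𝒳 : ObjectProperty (StableCM A)) (n : ℕ) :
    IsSumSummandShiftClosed (genIter 𝒳 (n + 1)) := by
  cases n <;> exact isSumSummandShiftClosed_gen _

lemma genIter_mono {𝒳 𝒴 : ObjectProperty (StableCM A)} (h : 𝒳 ≤ gen 𝒴) (n : ℕ) :
    genIter 𝒳 (n + 1) ≤ genIter 𝒴 (n + 1) := by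
  induction n with
  | zero => exact gen_mono h
  | succ n ih =>
    exact gen_mono ((star_mono (gen_mono h) (gen_mono (ih.trans (le_gen _)))).trans (le_gen _))

/-- An object of ⟨M⟩ generates no faster than M does. This closes the loop in the comparison of
generation times. -/
lemma genIter_eq_top_of_gen {M M' : StableCM A} (h : gen (fun X => X = M) M') {n : ℕ}
    (h' : genIter (fun X => X = M') (n + 1) = ⊤) : genIter (fun X => X = M) (n + 1) = ⊤ := by
  refine top_le_iff.1 (h' ▸ genIter_mono ?_ n)
  rintro _ rfl
  exact h

/-- A module which is the product of finitely many `X j` is their product in the stable category. -/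
lemma prop_of_bijective {P : ObjectProperty (StableCM A)} (hP : IsSumSummandShiftClosed P)
    {J : Type} [Finite J] {X : J → CM A} {Z : CM A} (r : ∀ j, Z.obj →ₗ[A] (X j).obj)
    (hr : Function.Bijective (LinearMap.pi r)) (hX : ∀ j, P (stab (X j))) : P (stab Z) := by
  have := hP.sums
  have := Fintype.ofFinite J
  classical
  let e := LinearEquiv.ofBijective (LinearMap.pi r) hr
  have he : ∀ z j, e z j = r j z := fun _ _ => rfl
  have he' : ∀ x j, r j (e.symm x) = x j := fun x j => by rw [← he, e.apply_symm_apply]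
  have lift : ∀ {W : StableCM A} (F : ∀ j, W ⟶ stab (X j)),
      ∃ G : W ⟶ stab Z, ∀ j, G ≫ (toStable A).map (homOf (r j)) = F j := by
    intro W F
    choose f hf using fun j => (toStable A).map_surjective (X := W.as) (Y := X j) (F j)
    refine ⟨(toStable A).map (X := W.as)
      (homOf (e.symm.toLinearMap ∘ₗ LinearMap.pi fun j => (f j).hom.hom)), fun j => ?_⟩
    refine (((toStable A).map_comp (X := W.as) _ _).symm.trans ?_).trans (hf j)
    congr 1
    ext x
    simp [he']
  -- If every component of a difference factors through a projective `Q j`, the difference factors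
  -- through their finite product.
  have ext' : ∀ {W : StableCM A} (F G : W ⟶ stab Z),
      (∀ j, F ≫ (toStable A).map (homOf (r j)) = G ≫ (toStable A).map (homOf (r j))) →
        F = G := by
    intro W F G h
    obtain ⟨f, rfl⟩ := (toStable A).map_surjective (X := W.as) (Y := Z) F
    obtain ⟨g, rfl⟩ := (toStable A).map_surjective (X := W.as) (Y := Z) G
    have h' : ∀ j, FactorsThroughProjective (r j ∘ₗ (f.hom.hom - g.hom.hom)) := by
      intro j
      have := (((toStable A).map_comp f (homOf (r j))).trans (h j)).trans
        ((toStable A).map_comp g (homOf (r j))).symm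
      simpa [LinearMap.comp_sub] using (map_eq_map_iff _ _).1 this
    refine (map_eq_map_iff _ _).2 ?_
    choose Q _ _ a b _ _ h using h'
    have : Module.Projective A (∀ j, Q j) :=
      .of_equiv (DFinsupp.linearEquivFunOnFintype (R := A) (M := Q))
    refine ⟨∀ j, Q j, inferInstance, inferInstance, LinearMap.pi a,
      e.symm.toLinearMap ∘ₗ LinearMap.pi fun j => b j ∘ₗ LinearMap.proj j, inferInstance, this, ?_⟩
    ext x
    apply e.injective
    ext j
    simpa [he, he'] using LinearMap.congr_fun (h j) x
  choose l hl using @lift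
  exact P.prop_of_isLimit_fan (F := Fan.mk (stab Z) fun j => (toStable A).map (homOf (r j)))
    (Fan.IsLimit.mk _ (fun s => l s.proj) (fun s j => hl s.proj j)
      fun s m hm => ext' _ _ fun j => (hm j).trans (hl s.proj j).symm) hX

/-- A module isomorphic to `X × Y` is a product of `X` and `Y` in the stable category. -/
lemma prop_of_linearEquiv_prod {P : ObjectProperty (StableCM A)} (hP : IsSumSummandShiftClosed P)
    {X Y Z : CM A} (e : Z.obj ≃ₗ[A] X.obj × Y.obj) (hX : P (stab X)) (hY : P (stab Y)) :
    P (stab Z) := by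
  refine prop_of_bijective hP (X := fun b : Bool => bif b then X else Y)
    (fun b => match b with
      | true => LinearMap.fst A _ _ ∘ₗ e.toLinearMap
      | false => LinearMap.snd A _ _ ∘ₗ e.toLinearMap) ⟨fun z w h => ?_, fun x => ?_⟩ ?_
  · exact e.injective (Prod.ext (congrFun h true) (congrFun h false))
  · refine ⟨e.symm (x true, x false), ?_⟩
    ext (_ | _)
    · exact congrArg Prod.snd (e.apply_symm_apply _)
    · exact congrArg Prod.fst (e.apply_symm_apply _)
  · rintro (_ | _)
    · exact hY
    · exact hX

/-! ### Transport of generation along a relation between modules -/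

/-- A relation between the objects of `CM(A)` and `CM(B)` which behaves like an exact functor of
the stable categories. -/
structure IsExactCorrespondence {B : Type u} [CommRing B] (Rel : CM A → CM B → Prop) : Prop where
  exists_rel : ∀ X, ∃ N, Rel X N
  retract : ∀ {X X' N N'}, Rel X N → Rel X' N' →
    StableSummand (A := A) X.obj X'.obj → StableSummand (A := B) N.obj N'.obj
  pi : ∀ {J : Type} [Finite J] (X : J → CM A) (N : J → CM B), (∀ j, Rel (X j) (N j)) →
    ∃ (hX : IsMCM A (ModuleCat.of A (∀ j, (X j).obj)))
      (hN : IsMCM B (ModuleCat.of B (∀ j, (N j).obj))), Rel (cmOf _ hX) (cmOf _ hN)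
  shift : ∀ {X N} (ξ : Cosyzygy X) {N'}, Rel X N → Rel ξ.shift N' → IsShift (stab N) (stab N')
  star : ∀ {X Y Z : CM A} (i : X.obj →ₗ[A] Y.obj) (p : Y.obj →ₗ[A] Z.obj),
    Function.Injective i → Function.Surjective p → Function.Exact i p → ∀ {N N''}, Rel X N →
    Rel Z N'' → ∃ N', Rel Y N' ∧ ∀ 𝒳 𝒴 : ObjectProperty (StableCM B), 𝒳 (stab N) →
      𝒴 (stab N'') → StableMCM.star 𝒳 𝒴 (stab N')

namespace IsExactCorrespondence

variable {B : Type u} [CommRing B] {Rel : CM A → CM B → Prop}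

/-- The objects all of whose partners satisfy `Q`. -/
def pull (Rel : CM A → CM B → Prop) (Q : ObjectProperty (StableCM B)) :
    ObjectProperty (StableCM A) := fun X => ∀ N, Rel X.as N → Q (stab N)

/-- Taken with the identity retract, this says that membership in a closed class does not depend on
which partner of an object is chosen. -/
lemma prop_of_retract (h : IsExactCorrespondence Rel) {Q : ObjectProperty (StableCM B)}
    (hQ : IsSumSummandShiftClosed Q) {X X' : StableCM A} (r : Retract X X') {N N' : CM B}
    (hN : Rel X.as N) (hN' : Rel X'.as N') (hQ' : Q (stab N')) : Q (stab N) := by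
  have := hQ.summands
  exact prop_of_stableSummand (h.retract hN hN'
    (nonempty_retract_iff (X := X.as) (Y := X'.as).1 ⟨r⟩)) hQ'

lemma isSumSummandShiftClosed_pull (h : IsExactCorrespondence Rel)
    {Q : ObjectProperty (StableCM B)} (hQ : IsSumSummandShiftClosed Q) :
    IsSumSummandShiftClosed (pull Rel Q) where
  sums := ⟨fun J _ => ⟨by
    rintro X ⟨L⟩ N hN
    choose K hK using fun j => h.exists_rel (L.diag.obj ⟨j⟩).as
    obtain ⟨hX, hK', hrel⟩ := h.pi _ K hK
    choose π hπ using fun j => (toStable A).map_surjective (X := X.as)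
      (Y := (L.diag.obj ⟨j⟩).as) (L.π.app ⟨j⟩)
    let c : Cone L.diag := ⟨stab (cmOf _ hX), Discrete.natTrans fun ⟨j⟩ =>
      (toStable A).map (X := cmOf _ hX) (Y := (L.diag.obj ⟨j⟩).as) (homOf (LinearMap.proj j))⟩
    -- X is a product only in the stable category. Its projections lift to module maps, which
    -- exhibit it as a retract of the module product; an isomorphism is not needed.
    have r : Retract X (stab (cmOf _ hX)) := by
      refine ⟨(toStable A).map (X := X.as) (Y := cmOf _ hX)
        (homOf (LinearMap.pi fun j => (π j).hom.hom)), L.isLimit.lift c, ?_⟩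
      refine L.isLimit.hom_ext fun ⟨j⟩ => ?_
      rw [Category.assoc, L.isLimit.fac]
      refine (((toStable A).map_comp (X := X.as) (Y := cmOf _ hX)
        (Z := (L.diag.obj ⟨j⟩).as) _ _).symm.trans ?_).trans
        ((hπ j).trans (Category.id_comp _).symm)
      congr 1
    refine h.prop_of_retract hQ r hN hrel (prop_of_bijective hQ (X := K)
      (fun j => LinearMap.proj j) Function.bijective_id fun j => ?_)
    exact L.prop_diag_obj ⟨j⟩ _ (hK j)⟩⟩
  summands := ⟨fun {X Y} r hY N hN => by
    obtain ⟨N', hN'⟩ := h.exists_rel Y.as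
    exact h.prop_of_retract hQ r hN hN' (hY N' hN')⟩
  shifts X Y := by
    rintro ⟨ξ, ⟨e⟩⟩
    obtain ⟨N', hN'⟩ := h.exists_rel ξ.shift
    constructor
    · intro hX N hN
      obtain ⟨K, hK⟩ := h.exists_rel X.as
      exact h.prop_of_retract hQ e.symm.retract hN hN'
        ((hQ.shifts _ _ (h.shift ξ hK hN')).1 (hX K hK))
    · intro hY K hK
      obtain ⟨N, hN⟩ := h.exists_rel Y.as
      exact (hQ.shifts _ _ (h.shift ξ hK hN')).2
        (h.prop_of_retract hQ e.retract hN' hN (hY N hN))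

lemma gen_le_pull (h : IsExactCorrespondence Rel) {𝒳 : ObjectProperty (StableCM A)}
    {𝒴 : ObjectProperty (StableCM B)} (h' : 𝒳 ≤ pull Rel (gen 𝒴)) : gen 𝒳 ≤ pull Rel (gen 𝒴) :=
  gen_le (h.isSumSummandShiftClosed_pull (isSumSummandShiftClosed_gen _)) h'

/-- Because `pull` of a closed class is closed, each application of ⟨·⟩ only has to be checked on
generators. For an extension, the transported sequence brings its own middle partner and its own end
partners, which are compared with the given ones through `prop_of_retract`. -/
lemma genIter_le_pull (h : IsExactCorrespondence Rel) {𝒳 : ObjectProperty (StableCM A)}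
    {𝒴 : ObjectProperty (StableCM B)} (h' : 𝒳 ≤ pull Rel (gen 𝒴)) (n : ℕ) :
    genIter 𝒳 (n + 1) ≤ pull Rel (genIter 𝒴 (n + 1)) := by
  induction n with
  | zero => exact h.gen_le_pull h'
  | succ n ih =>
    refine h.gen_le_pull fun M hM N hN => ?_
    obtain ⟨X, Y, Z, i, p, hi, hp, he, hX, ⟨β⟩, W, hW, ⟨γ⟩⟩ := hM.exists_exact
    obtain ⟨K, hK⟩ := h.exists_rel X
    obtain ⟨K'', hK''⟩ := h.exists_rel Z
    obtain ⟨K', hK', H⟩ := h.star i p hi hp he hK hK''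
    have hW' := h.gen_le_pull (fun V hV L hL => le_gen _ _ (ih V hV L hL)) W hW
    obtain ⟨L, hL⟩ := h.exists_rel W.as
    refine h.prop_of_retract (isSumSummandShiftClosed_gen _) β.symm.retract hN hK'
      (le_gen _ _ (H _ _ (h.gen_le_pull h' _ hX K hK) ?_))
    exact h.prop_of_retract (isSumSummandShiftClosed_gen _) γ.retract hK'' hL (hW' L hL)

/-- If `M` generates `CM(A)` in `n` steps then its partner `N` generates every object which is a
direct summand of a partner. -/
lemma genIter_eq_top (h : IsExactCorrespondence Rel) {M : CM A} {N : CM B} (hMN : Rel M N) {n : ℕ}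
    (hM : genIter (fun X => X = stab M) (n + 1) = ⊤)
    (hB : ∀ K : CM B, ∃ X K', Rel X K' ∧ StableSummand (A := B) K.obj K'.obj) :
    genIter (fun X => X = stab N) (n + 1) = ⊤ := by
  refine top_le_iff.1 fun K _ => ?_
  obtain ⟨X, K', hX, hK⟩ := hB K.as
  have hcl := isSumSummandShiftClosed_genIter (fun X => X = stab N) n
  have := hcl.summands
  refine prop_of_stableSummand (X := K.as) hK (h.genIter_le_pull ?_ n (stab X) (by rw [hM]; trivial) K' hX)
  rintro _ rfl K hK
  exact h.prop_of_retract (isSumSummandShiftClosed_gen _) (Retract.refl (stab M)) hK hMN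
    (le_gen _ _ rfl)

end IsExactCorrespondence

end Generation

/-! ## Modules over a double cover -/

section DoubleCover

open scoped QuadraticAlgebra

variable {S B : Type u} [CommRing S] [CommRing B] [Algebra S B] {f : S}
  (e : B ≃ₐ[S] QuadraticAlgebra S (-f) 0)

/-- The square root of `-f` in the double cover. -/
def root : B := e.symm ω

@[simp] lemma root_re : (e (root e)).re = 0 := by simp [root]

@[simp] lemma root_im : (e (root e)).im = 1 := by simp [root]

lemma root_mul_root : root e * root e = algebraMap S B (-f) := by
  apply e.injective
  ext <;> simp

lemma eq_add_mul_root (b : B) : b = algebraMap S B (e b).re + algebraMap S B (e b).im * root e := by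
  apply e.injective
  ext <;> simp

/-- The reduction of the double cover modulo the root. -/
def reduction : B →+* S ⧸ Ideal.span {f} where
  toFun b := Ideal.Quotient.mk _ (e b).re
  map_one' := by simp
  map_zero' := by simp
  map_add' _ _ := by simp
  map_mul' b c := by
    have : Ideal.Quotient.mk (Ideal.span {f}) f = 0 :=
      Ideal.Quotient.eq_zero_iff_mem.2 (Ideal.mem_span_singleton_self f)
    simp [this]

lemma reduction_apply (b : B) : reduction e b = Ideal.Quotient.mk _ (e b).re := rfl

@[simp] lemma reduction_root : reduction e (root e) = 0 := by simp [reduction_apply]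

@[simp] lemma reduction_algebraMap (s : S) :
    reduction e (algebraMap S B s) = Ideal.Quotient.mk _ s := by simp [reduction_apply]

lemma reduction_surjective : Function.Surjective (reduction e) := fun r => by
  obtain ⟨s, rfl⟩ := Ideal.Quotient.mk_surjective r
  exact ⟨algebraMap S B s, by simp⟩

section Module

variable {N N' : Type u} [AddCommGroup N] [Module B N] [Module S N] [IsScalarTower S B N]
  [AddCommGroup N'] [Module B N'] [Module S N'] [IsScalarTower S B N']

lemma smul_eq (b : B) (n : N) : b • n = (e b).re • n + (e b).im • root e • n := by
  conv_lhs => rw [eq_add_mul_root e b]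
  rw [add_smul, mul_smul, algebraMap_smul, algebraMap_smul]

lemma root_smul_root_smul (n : N) : root e • root e • n = -(f • n) := by
  rw [← mul_smul, root_mul_root, algebraMap_smul, neg_smul]

/-- An `S`-linear map commuting with the root is linear over the double cover. -/
def ofCommutes (g : N →ₗ[S] N') (h : ∀ n, g (root e • n) = root e • g n) : N →ₗ[B] N' where
  toFun := g
  map_add' := map_add g
  map_smul' b n := by
    rw [RingHom.id_apply, smul_eq e b n, smul_eq e b (g n), map_add, map_smul, map_smul, h]

@[simp] lemma ofCommutes_apply (g : N →ₗ[S] N') (h : ∀ n, g (root e • n) = root e • g n) (n : N) :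
    ofCommutes e g h n = g n := rfl

end Module

/-! ### The module `B ⊗ V` -/

/-- The module over the double cover induced from the `S`-module `V`, with `V × V` as underlying
`S`-module; the root acts by `(v, w) ↦ (-f w, v)`. -/
def Dbl (_e : B ≃ₐ[S] QuadraticAlgebra S (-f) 0) (V : Type u) : Type u := V × V

section Dbl

variable {V : Type u} [AddCommGroup V] [Module S V]

instance : AddCommGroup (Dbl e V) := inferInstanceAs (AddCommGroup (V × V))

instance : Module S (Dbl e V) := inferInstanceAs (Module S (V × V))

instance [Module.Finite S V] : Module.Finite S (Dbl e V) :=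
  inferInstanceAs (Module.Finite S (V × V))

/-- The first coordinate. -/
def Dbl.fst : Dbl e V →ₗ[S] V := LinearMap.fst S V V

/-- The second coordinate. -/
def Dbl.snd : Dbl e V →ₗ[S] V := LinearMap.snd S V V

/-- The element with given coordinates. -/
def Dbl.mk (v w : V) : Dbl e V := (v, w)

@[simp] lemma Dbl.fst_mk (v w : V) : Dbl.fst e (Dbl.mk e v w) = v := rfl

@[simp] lemma Dbl.snd_mk (v w : V) : Dbl.snd e (Dbl.mk e v w) = w := rfl

variable {e} in
@[ext] lemma Dbl.ext {z z' : Dbl e V} (h : Dbl.fst e z = Dbl.fst e z')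
    (h' : Dbl.snd e z = Dbl.snd e z') : z = z' := Prod.ext h h'

instance : SMul B (Dbl e V) := ⟨fun b z => Dbl.mk e
  ((e b).re • Dbl.fst e z - (f * (e b).im) • Dbl.snd e z)
  ((e b).im • Dbl.fst e z + (e b).re • Dbl.snd e z)⟩

lemma Dbl.fst_smul (b : B) (z : Dbl e V) : Dbl.fst e (b • z) =
    (e b).re • Dbl.fst e z - (f * (e b).im) • Dbl.snd e z := rfl

lemma Dbl.snd_smul (b : B) (z : Dbl e V) : Dbl.snd e (b • z) =
    (e b).im • Dbl.fst e z + (e b).re • Dbl.snd e z := rfl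

instance : Module B (Dbl e V) where
  one_smul z := by ext <;> simp [Dbl.fst_smul, Dbl.snd_smul]
  mul_smul b c z := by
    ext
    · simp only [Dbl.fst_smul, Dbl.snd_smul, map_mul, QuadraticAlgebra.re_mul,
        QuadraticAlgebra.im_mul]
      module
    · simp only [Dbl.fst_smul, Dbl.snd_smul, map_mul, QuadraticAlgebra.re_mul,
        QuadraticAlgebra.im_mul]
      module
  smul_zero b := by ext <;> simp [Dbl.fst_smul, Dbl.snd_smul]
  zero_smul z := by ext <;> simp [Dbl.fst_smul, Dbl.snd_smul]
  smul_add b z w := by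
    ext <;> simp only [Dbl.fst_smul, Dbl.snd_smul, map_add] <;> module
  add_smul b c z := by
    ext <;> simp only [Dbl.fst_smul, Dbl.snd_smul, map_add, QuadraticAlgebra.re_add,
        QuadraticAlgebra.im_add] <;> module

instance : IsScalarTower S B (Dbl e V) where
  smul_assoc s b z := by
    ext <;> simp only [Dbl.fst_smul, Dbl.snd_smul, map_smul, QuadraticAlgebra.re_smul,
        QuadraticAlgebra.im_smul, smul_eq_mul] <;> module

@[simp] lemma Dbl.fst_root_smul (z : Dbl e V) : Dbl.fst e (root e • z) = -(f • Dbl.snd e z) := by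
  simp [Dbl.fst_smul]

@[simp] lemma Dbl.snd_root_smul (z : Dbl e V) : Dbl.snd e (root e • z) = Dbl.fst e z := by
  simp [Dbl.snd_smul]

instance [Module.Finite S V] : Module.Finite B (Dbl e V) :=
  Module.Finite.of_restrictScalars_finite S B (Dbl e V)

variable {T : Type u} [AddCommGroup T] [Module B T] [Module S T] [IsScalarTower S B T]

/-- Maps out of the induced module. -/
def Dbl.desc (g : V →ₗ[S] T) : Dbl e V →ₗ[B] T :=
  ofCommutes e (g ∘ₗ Dbl.fst e + (Algebra.lsmul S S T (root e)) ∘ₗ g ∘ₗ Dbl.snd e) fun z => by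
    simp [root_smul_root_smul, add_comm]

@[simp] lemma Dbl.desc_apply (g : V →ₗ[S] T) (z : Dbl e V) :
    Dbl.desc e g z = g (Dbl.fst e z) + root e • g (Dbl.snd e z) := rfl

/-- Maps into the induced module. -/
def Dbl.lift (g : T →ₗ[S] V) : T →ₗ[B] Dbl e V :=
  ofCommutes e
    { toFun := fun t => Dbl.mk e (g (root e • t)) (g t)
      map_add' := fun t t' => by ext <;> simp
      map_smul' := fun s t => by ext <;> simp [smul_comm (root e) s t] } fun t => by
    ext <;> simp [root_smul_root_smul]

@[simp] lemma Dbl.fst_lift (g : T →ₗ[S] V) (t : T) : Dbl.fst e (Dbl.lift e g t) = g (root e • t) :=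
  rfl

@[simp] lemma Dbl.snd_lift (g : T →ₗ[S] V) (t : T) : Dbl.snd e (Dbl.lift e g t) = g t := rfl

/-- Induction is left adjoint to restriction: lift V over S, then extend to B. -/
instance [Module.Projective S V] : Module.Projective B (Dbl e V) :=
  .of_lifting_property'' fun π hπ => by
    obtain ⟨h, hh⟩ := Module.projective_lifting_property (π.restrictScalars S)
      (LinearMap.inl S V V : V →ₗ[S] Dbl e V) hπ
    have hh' : ∀ v, π (h v) = Dbl.mk e v 0 := LinearMap.congr_fun hh
    refine ⟨Dbl.desc e h, ?_⟩
    ext z <;> simp [hh', Dbl.fst_smul, Dbl.snd_smul]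

end Dbl

/-! ### The twist by the involution of the double cover -/

/-- The module `N` with the opposite action of the root. -/
def Twist (_e : B ≃ₐ[S] QuadraticAlgebra S (-f) 0) (N : Type u) : Type u := N

section Twist

variable {N : Type u} [AddCommGroup N] [Module B N] [Module S N] [IsScalarTower S B N]

instance : AddCommGroup (Twist e N) := inferInstanceAs (AddCommGroup N)

instance : Module S (Twist e N) := inferInstanceAs (Module S N)

/-- The identity map to the twist. -/
def toTwist : N ≃ₗ[S] Twist e N := LinearEquiv.refl S N

instance : SMul B (Twist e N) := ⟨fun b n =>
  toTwist e ((e b).re • (toTwist e).symm n - (e b).im • root e • (toTwist e).symm n)⟩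

lemma twist_smul (b : B) (n : N) :
    b • toTwist e n = toTwist e ((e b).re • n - (e b).im • root e • n) := rfl

instance : Module B (Twist e N) where
  one_smul := (toTwist e).surjective.forall.2 fun n => by simp [twist_smul]
  mul_smul b c := (toTwist e).surjective.forall.2 fun n => by
    simp only [twist_smul, map_mul, QuadraticAlgebra.re_mul, QuadraticAlgebra.im_mul, smul_sub,
      smul_comm (root e), root_smul_root_smul]
    congr 1
    module
  smul_zero b := (twist_smul e b 0).trans (by simp)
  zero_smul := (toTwist e).surjective.forall.2 fun n => by simp [twist_smul]
  smul_add b := (toTwist e).surjective.forall.2 fun n => (toTwist e).surjective.forall.2 fun m => by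
    rw [← map_add]
    simp only [twist_smul, smul_add]
    rw [← map_add]
    congr 1
    module
  add_smul b c := (toTwist e).surjective.forall.2 fun n => by
    simp only [twist_smul, map_add, QuadraticAlgebra.re_add, QuadraticAlgebra.im_add]
    rw [← map_add]
    congr 1
    module

instance : IsScalarTower S B (Twist e N) where
  smul_assoc s b := (toTwist e).surjective.forall.2 fun n => by
    simp only [twist_smul, map_smul, QuadraticAlgebra.re_smul, QuadraticAlgebra.im_smul, smul_eq_mul]
    rw [← map_smul, smul_sub, smul_smul, smul_smul]

@[simp] lemma root_smul_toTwist (n : N) : root e • toTwist e n = - toTwist e (root e • n) := by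
  rw [twist_smul]
  simp

/-- The projection of the cosyzygy sequence `0 → N → Dbl N → Twist N → 0`. -/
def dblToTwist : Dbl e N →ₗ[B] Twist e N :=
  ofCommutes e ((toTwist e).toLinearMap ∘ₗ
    (Dbl.fst e - (Algebra.lsmul S S N (root e)) ∘ₗ Dbl.snd e)) fun z => by
      simp only [LinearMap.comp_apply, LinearMap.sub_apply, LinearEquiv.coe_coe, map_sub,
        Dbl.fst_root_smul, Dbl.snd_root_smul, Algebra.lsmul_coe, smul_sub, root_smul_toTwist,
        root_smul_root_smul, map_neg]
      abel

@[simp] lemma dblToTwist_apply (z : Dbl e N) :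
    dblToTwist e z = toTwist e (Dbl.fst e z - root e • Dbl.snd e z) := rfl

lemma dblToTwist_surjective : Function.Surjective (dblToTwist e (N := N)) :=
  (toTwist e).surjective.forall.2 fun n => ⟨Dbl.mk e n 0, by simp⟩

lemma lift_injective : Function.Injective (Dbl.lift e (LinearMap.id : N →ₗ[S] N)) :=
  fun _ _ h => congrArg (Dbl.snd e) h

/-- The pair (v, w) dies under v - yw exactly when it equals (yw, w), the image of w. -/
lemma exact_lift_dblToTwist :
    Function.Exact (Dbl.lift e (LinearMap.id : N →ₗ[S] N)) (dblToTwist e) := by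
  intro z
  simp only [dblToTwist_apply, EmbeddingLike.map_eq_zero_iff, sub_eq_zero]
  constructor
  · intro h
    exact ⟨Dbl.snd e z, by ext <;> simp [h]⟩
  · rintro ⟨n, rfl⟩
    simp

end Twist

end DoubleCover

/-! ## The reduction functor -/

section Reduction

open scoped QuadraticAlgebra

variable {S B : Type u} [CommRing S] [CommRing B] [Algebra S B] {f : S}

/-- The hypotheses on a double cover `B` of a hypersurface `S ⧸ (f)`: maximal Cohen-Macaulay
modules on both sides are described by means of projective `S`-modules. -/
structure IsDoubleCover (e : B ≃ₐ[S] QuadraticAlgebra S (-f) 0) : Prop where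
  isNoetherianRing : IsNoetherianRing S
  mem_nonZeroDivisors : f ∈ nonZeroDivisors S
  isUnit_two : IsUnit (2 : S)
  isMCM_iff : ∀ (N : Type u) [AddCommGroup N] [Module B N] [Module S N] [IsScalarTower S B N],
    IsMCM B (ModuleCat.of B N) ↔ Module.Finite S N ∧ Module.Projective S N
  isMCM_quotient_iff : ∀ (M : Type u) [AddCommGroup M] [Module (S ⧸ Ideal.span {f}) M]
    [Module S M] [IsScalarTower S (S ⧸ Ideal.span {f}) M] (V : Type u) [AddCommGroup V]
    [Module S V] [Module.Finite S V] [Module.Projective S V] (p : V →ₗ[S] M),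
    Function.Surjective p → (IsMCM (S ⧸ Ideal.span {f}) (ModuleCat.of (S ⧸ Ideal.span {f}) M) ↔
      Module.Projective S (LinearMap.ker p))

/-- The `S`-module underlying a module over an `S`-algebra. -/
@[reducible] def restrictModule {A : Type u} [CommRing A] [Algebra S A]
    (M : ModuleCat.{u} A) : Module S M := Module.compHom M (algebraMap S A)

attribute [local instance low] restrictModule

lemma isScalarTower_restrictModule {A : Type u} [CommRing A] [Algebra S A] (M : ModuleCat.{u} A) :
    IsScalarTower S A M :=
  ⟨fun s a m => by rw [Algebra.smul_def, mul_smul]; rfl⟩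

attribute [local instance low] isScalarTower_restrictModule

variable {e : B ≃ₐ[S] QuadraticAlgebra S (-f) 0}

namespace IsDoubleCover

lemma finite (h : IsDoubleCover e) (N : CM B) : Module.Finite S N.obj :=
  ((h.isMCM_iff N.obj).1 N.property).1

lemma projective (h : IsDoubleCover e) (N : CM B) : Module.Projective S N.obj :=
  ((h.isMCM_iff N.obj).1 N.property).2

lemma smul_injective (h : IsDoubleCover e) (N : Type u) [AddCommGroup N] [Module S N]
    [Module.Projective S N] : Function.Injective (fun n : N => f • n) :=
  Module.Flat.isSMulRegular_of_nonZeroDivisors h.mem_nonZeroDivisors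

lemma root_smul_injective (h : IsDoubleCover e) (N : Type u) [AddCommGroup N] [Module S N]
    [Module B N] [IsScalarTower S B N] [Module.Projective S N] :
    Function.Injective (fun n : N => root e • n) := fun n n' hn => by
  refine h.smul_injective N (neg_injective ?_)
  rw [← root_smul_root_smul e, ← root_smul_root_smul e]
  exact congrArg (root e • ·) hn

/-- The cosyzygy of a maximal Cohen-Macaulay module over the double cover. -/
def cosyzygy (h : IsDoubleCover e) (N : CM B) : Cosyzygy N :=
  have := h.finite N
  have := h.projective N
  Cosyzygy.of (Z := cmOf (Twist e N.obj) ((h.isMCM_iff _).2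
    ⟨inferInstanceAs (Module.Finite S N.obj), inferInstanceAs (Module.Projective S N.obj)⟩))
    (inferInstanceAs (Module.Finite B (Dbl e N.obj)))
    (inferInstanceAs (Module.Projective B (Dbl e N.obj))) (Dbl.lift e LinearMap.id) (dblToTwist e)
    (lift_injective e) (dblToTwist_surjective e) (exact_lift_dblToTwist e)

/-- The quotient Z is projective over S, so the sequence splits over S. The S-linear retraction Y →
X corresponds, by the coinduced property `Dbl.lift`, to a B-linear map Y → `Dbl e X` extending X →
`Dbl e X`. -/
lemma exists_cosyzygy_extension (h : IsDoubleCover e) {X Y Z : CM B} (i : X.obj →ₗ[B] Y.obj)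
    (p : Y.obj →ₗ[B] Z.obj) (hi : Function.Injective i) (hp : Function.Surjective p)
    (hip : Function.Exact i p) :
    ∃ (ξ : Cosyzygy X) (b : Y.obj →ₗ[B] ξ.F), ∀ x, b (i x) = ξ.ι.hom x := by
  have := h.projective Z
  obtain ⟨s, hs⟩ := Module.projective_lifting_property (p.restrictScalars S) LinearMap.id hp
  have hs' : ∀ z, p (s z) = z := LinearMap.congr_fun hs
  have hr : ∀ y, ∃ x, i x = y - s (p y) := fun y => (hip _).1 (by simp [hs'])
  choose r hr using hr
  let c : Y.obj →ₗ[S] X.obj :=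
    { toFun := r
      map_add' := fun y y' => hi (by simp only [map_add, hr]; abel)
      map_smul' := fun t y => hi (by
        have h₁ := (p.restrictScalars S).map_smul t y
        have h₂ := (i.restrictScalars S).map_smul t (r y)
        simp only [LinearMap.restrictScalars_apply] at h₁ h₂
        simp only [hr, RingHom.id_apply, h₁, h₂, map_smul, smul_sub]) }
  refine ⟨h.cosyzygy X, Dbl.lift e c, fun x => ?_⟩
  have hc : ∀ x, c (i x) = x := fun x => hi (by
    have := (hip (i x)).2 ⟨x, rfl⟩
    simp [c, hr, this])
  change _ = Dbl.lift e LinearMap.id x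
  refine Dbl.ext ?_ (hc x)
  change c (root e • i x) = root e • x
  rw [← map_smul, hc]

end IsDoubleCover

variable {N N' M M' : Type u} [AddCommGroup N] [Module B N] [AddCommGroup N'] [Module B N']
  [AddCommGroup M] [Module (S ⧸ Ideal.span {f}) M] [AddCommGroup M']
  [Module (S ⧸ Ideal.span {f}) M']

/-- The semilinear map `q` identifies `M` with the reduction of `N` modulo the root. -/
structure IsReduction (q : N →ₛₗ[reduction e] M) : Prop where
  surjective : Function.Surjective q
  eq_zero_iff : ∀ n, q n = 0 ↔ ∃ n', n = root e • n'

namespace IsReduction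

variable {q : N →ₛₗ[reduction e] M} {q' : N' →ₛₗ[reduction e] M'}

lemma exists_desc (hq : IsReduction q) (g : N →ₛₗ[reduction e] M') :
    ∃ h : M →ₗ[S ⧸ Ideal.span {f}] M', ∀ n, h (q n) = g n := by
  have key : ∀ n n', q n = q n' → g n = g n' := by
    intro n n' h
    rw [← sub_eq_zero, ← map_sub, hq.eq_zero_iff] at h
    obtain ⟨k, hk⟩ := h
    rw [← sub_eq_zero, ← map_sub, hk, map_smulₛₗ, reduction_root, zero_smul]
  let t := Function.surjInv hq.surjective
  have ht : ∀ m, q (t m) = m := Function.surjInv_eq hq.surjective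
  refine ⟨{ toFun := fun m => g (t m), map_add' := fun m m' => ?_, map_smul' := fun r m => ?_ },
    fun n => key _ _ (ht _)⟩
  · rw [← map_add]
    exact key _ _ (by simp [ht])
  · obtain ⟨b, rfl⟩ := reduction_surjective e r
    rw [RingHom.id_apply, ← map_smulₛₗ]
    exact key _ _ (by simp [ht])

lemma exists_map (hq : IsReduction q) (q' : N' →ₛₗ[reduction e] M') (g : N →ₗ[B] N') :
    ∃ h : M →ₗ[S ⧸ Ideal.span {f}] M', ∀ n, h (q n) = q' (g n) :=
  hq.exists_desc (q'.comp g)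

lemma finite (hq : IsReduction q) [Module.Finite B N] : Module.Finite (S ⧸ Ideal.span {f}) M :=
  Module.Finite.of_surjective q hq.surjective

/-- Base change of a projective: a lifting problem over S/(f) is viewed over B through `reduction`,
solved there, and descended. -/
lemma projective (hq : IsReduction q) [Module.Projective B N] :
    Module.Projective (S ⧸ Ideal.span {f}) M := by
  refine .of_lifting_property'' fun π hπ => ?_
  let := Module.compHom (M →₀ S ⧸ Ideal.span {f}) (reduction e)
  let := Module.compHom M (reduction e)
  let π' : (M →₀ S ⧸ Ideal.span {f}) →ₗ[B] M :=
    { toFun := π, map_add' := map_add π, map_smul' := fun b x => π.map_smul (reduction e b) x }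
  let q₁ : N →ₗ[B] M :=
    { toFun := q, map_add' := map_add q, map_smul' := fun b x => map_smulₛₗ q b x }
  obtain ⟨t, ht⟩ := Module.projective_lifting_property π' q₁ hπ
  obtain ⟨s, hs⟩ := hq.exists_desc (M' := M →₀ S ⧸ Ideal.span {f})
    { toFun := t, map_add' := map_add t, map_smul' := fun b x => t.map_smul b x }
  refine ⟨s, LinearMap.ext (hq.surjective.forall.2 fun n => ?_)⟩
  rw [LinearMap.comp_apply, hs]
  exact LinearMap.congr_fun ht n

-- The model is N/yN, an S/(f)-module because f = -y² dies in B/(y).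
variable (e) in
lemma exists_isReduction (N : Type u) [AddCommGroup N] [Module B N] :
    ∃ (M : Type u) (_ : AddCommGroup M) (_ : Module (S ⧸ Ideal.span {f}) M)
      (q : N →ₛₗ[reduction e] M), IsReduction q := by
  have hf : algebraMap S B f ∈ Ideal.span {root e} := by
    rw [← neg_mem_iff, ← map_neg, ← root_mul_root]
    exact Ideal.mul_mem_left _ _ (Ideal.mem_span_singleton_self _)
  let φ : S ⧸ Ideal.span {f} →+* B ⧸ Ideal.span {root e} :=
    Ideal.quotientMap _ (algebraMap S B) (by
      rw [Ideal.span_singleton_le_iff_mem]; exact hf)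
  have hφ : ∀ b, φ (reduction e b) = Ideal.Quotient.mk _ b := by
    intro b
    have hb : algebraMap S B (e b).re - b = algebraMap S B (-(e b).im) * root e := by
      rw [map_neg]
      linear_combination -eq_add_mul_root e b
    rw [reduction_apply, Ideal.quotientMap_mk, Ideal.Quotient.eq, hb]
    exact Ideal.mul_mem_left _ _ (Ideal.mem_span_singleton_self (root e))
  let M := N ⧸ (Ideal.span {root e} • (⊤ : Submodule B N))
  let : Module (S ⧸ Ideal.span {f}) M := Module.compHom M φ
  refine ⟨M, inferInstance, this,
    { toFun := Submodule.Quotient.mk, map_add' := fun _ _ => rfl, map_smul' := fun b n => ?_ },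
    Submodule.Quotient.mk_surjective _, fun n => ?_⟩
  · change _ = φ (reduction e b) • (Submodule.Quotient.mk n : M)
    rw [hφ]
    rfl
  · change (Submodule.Quotient.mk n : M) = 0 ↔ _
    rw [Submodule.Quotient.mk_eq_zero, Submodule.ideal_span_singleton_smul,
      Submodule.mem_smul_pointwise_iff_exists]
    simp [eq_comm]

/-- N itself serves as the projective S-module covering M; the kernel is yN ≅ N, again projective.
-/
lemma isMCM (h : IsDoubleCover e) (hq : IsReduction q)
    (hN : IsMCM B (ModuleCat.of B N)) : IsMCM _ (ModuleCat.of (S ⧸ Ideal.span {f}) M) := by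
  let := Module.compHom N (algebraMap S B)
  have : IsScalarTower S B N := isScalarTower_restrictModule (ModuleCat.of B N)
  let := Module.compHom M (algebraMap S (S ⧸ Ideal.span {f}))
  have : IsScalarTower S (S ⧸ Ideal.span {f}) M :=
    isScalarTower_restrictModule (ModuleCat.of (S ⧸ Ideal.span {f}) M)
  obtain ⟨_, _⟩ := (h.isMCM_iff N).1 hN
  let p : N →ₗ[S] M :=
    { toFun := q, map_add' := map_add q, map_smul' := fun s n => by
        rw [← algebraMap_smul B s n, map_smulₛₗ, reduction_algebraMap]
        rfl }
  rw [h.isMCM_quotient_iff M N p hq.surjective]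
  refine .of_equiv (LinearEquiv.ofBijective
    (LinearMap.codRestrict (LinearMap.ker p) (Algebra.lsmul S S N (root e)) fun n =>
      (hq.eq_zero_iff _).2 ⟨n, rfl⟩) ⟨fun n n' hn => ?_, fun n => ?_⟩)
  · exact h.root_smul_injective N (congrArg Subtype.val hn)
  · obtain ⟨k, hk⟩ := (hq.eq_zero_iff _).1 n.2
    exact ⟨k, Subtype.ext hk.symm⟩

lemma factorsThroughProjective (hq : IsReduction q) {g : N →ₗ[B] N'}
    {h : M →ₗ[S ⧸ Ideal.span {f}] M'} (hg : ∀ n, h (q n) = q' (g n))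
    (H : FactorsThroughProjective g) : FactorsThroughProjective h := by
  obtain ⟨P, _, _, a, b, _, _, rfl⟩ := H
  obtain ⟨P', _, _, q₁, h₁⟩ := exists_isReduction e P
  obtain ⟨a', ha⟩ := hq.exists_map q₁ a
  obtain ⟨b', hb⟩ := h₁.exists_map q' b
  exact ⟨P', _, _, a', b', h₁.finite, h₁.projective,
    LinearMap.ext (hq.surjective.forall.2 fun n => by simp [hg, ha, hb])⟩

lemma stableSummand (hq : IsReduction q) (hq' : IsReduction q')
    (H : StableSummand (A := B) N N') : StableSummand (A := S ⧸ Ideal.span {f}) M M' := by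
  obtain ⟨i, r, H⟩ := H
  obtain ⟨i', hi⟩ := hq.exists_map q' i
  obtain ⟨r', hr⟩ := hq'.exists_map q r
  exact ⟨i', r', hq.factorsThroughProjective (q' := q) (fun n => by simp [hi, hr]) H⟩

/-- The snake lemma for multiplication by y: injectivity of y on the quotient Z is what preserves
injectivity on the left. -/
lemma exact {X Y Z X' Y' Z' : Type u} [AddCommGroup X] [Module B X] [AddCommGroup Y] [Module B Y]
    [AddCommGroup Z] [Module B Z] [AddCommGroup X'] [Module (S ⧸ Ideal.span {f}) X']
    [AddCommGroup Y'] [Module (S ⧸ Ideal.span {f}) Y'] [AddCommGroup Z']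
    [Module (S ⧸ Ideal.span {f}) Z'] {qX : X →ₛₗ[reduction e] X'} {qY : Y →ₛₗ[reduction e] Y'}
    {qZ : Z →ₛₗ[reduction e] Z'} (hX : IsReduction qX) (hY : IsReduction qY) (hZ : IsReduction qZ)
    (hinj : Function.Injective (fun z : Z => root e • z)) {i : X →ₗ[B] Y} {p : Y →ₗ[B] Z}
    (hi : Function.Injective i) (hp : Function.Surjective p) (hip : Function.Exact i p)
    {i' : X' →ₗ[S ⧸ Ideal.span {f}] Y'} {p' : Y' →ₗ[S ⧸ Ideal.span {f}] Z'}
    (hi' : ∀ x, i' (qX x) = qY (i x)) (hp' : ∀ y, p' (qY y) = qZ (p y)) :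
    Function.Injective i' ∧ Function.Surjective p' ∧ Function.Exact i' p' := by
  refine ⟨(injective_iff_map_eq_zero i').2 (hX.surjective.forall.2 fun x hx => ?_),
    hZ.surjective.forall.2 (hp.forall.2 fun y => ⟨qY y, hp' y⟩),
    hY.surjective.forall.2 fun y => ⟨fun hy => ?_, ?_⟩⟩
  · rw [hi', hY.eq_zero_iff] at hx
    obtain ⟨y, hy⟩ := hx
    have h0 : p y = 0 := hinj (by simp [← map_smul, ← hy, hip.apply_apply_eq_zero])
    obtain ⟨x', rfl⟩ := (hip y).1 h0
    rw [← map_smul] at hy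
    exact (hX.eq_zero_iff _).2 ⟨x', hi hy⟩
  · rw [hp', hZ.eq_zero_iff] at hy
    obtain ⟨z, hz⟩ := hy
    obtain ⟨w, rfl⟩ := hp z
    rw [← map_smul, ← sub_eq_zero, ← map_sub] at hz
    obtain ⟨x, hx⟩ := (hip _).1 hz
    refine ⟨qX x, ?_⟩
    rw [hi', hx, map_sub, (hY.eq_zero_iff (root e • w)).2 ⟨w, rfl⟩, sub_zero]
  · rintro ⟨x', hx⟩
    obtain ⟨x, rfl⟩ := hX.surjective x'
    rw [hi'] at hx
    rw [← hx, hp', hip.apply_apply_eq_zero, map_zero]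

end IsReduction

/-- `M` is the reduction of `N`. -/
def ReductionRel (e : B ≃ₐ[S] QuadraticAlgebra S (-f) 0) (N : CM B)
    (M : CM (S ⧸ Ideal.span {f})) : Prop :=
  ∃ q : N.obj →ₛₗ[reduction e] M.obj, IsReduction q

lemma IsDoubleCover.reductionRel_exists (h : IsDoubleCover e) (N : CM B) :
    ∃ M, ReductionRel e N M := by
  obtain ⟨M, _, _, q, hq⟩ := IsReduction.exists_isReduction e N.obj
  exact ⟨cmOf M (hq.isMCM h N.property), q, hq⟩

/-- Reduction of a cosyzygy sequence. -/
lemma IsDoubleCover.exists_cosyzygy_reduction (h : IsDoubleCover e) {X : CM B}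
    (ξ : Cosyzygy X) {M M' : CM (S ⧸ Ideal.span {f})} {q : X.obj →ₛₗ[reduction e] M.obj}
    (hq : IsReduction q) (hM' : ReductionRel e ξ.shift M') :
    ∃ (ξ' : Cosyzygy M) (qF : ξ.F →ₛₗ[reduction e] ξ'.F), ξ'.shift = M' ∧ IsReduction qF ∧
      ∀ x, ξ'.ι.hom (q x) = qF (ξ.ι.hom x) := by
  obtain ⟨q', hq'⟩ := hM'
  obtain ⟨F, _, _, qF, hF⟩ := IsReduction.exists_isReduction e ξ.F
  obtain ⟨ι, hι⟩ := hq.exists_map qF ξ.ι.hom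
  obtain ⟨π, hπ⟩ := hF.exists_map q' ξ.π.hom
  have := h.projective ξ.shift
  obtain ⟨h₁, h₂, h₃⟩ := ξ.exact
  obtain ⟨h₁', h₂', h₃'⟩ := IsReduction.exact hq hF hq'
    (h.root_smul_injective ξ.shift.obj) h₁ h₂ h₃ hι hπ
  have := ξ.finite
  have := ξ.projective
  exact ⟨Cosyzygy.of hF.finite hF.projective ι π h₁' h₂' h₃', qF, rfl, hF, hι⟩

/-- Reduction is exact on these sequences and preserves projectives, so it carries a cosyzygy
sequence to a cosyzygy sequence, and an extension along it to such an extension. -/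
theorem IsDoubleCover.isExactCorrespondence_reductionRel (h : IsDoubleCover e) :
    IsExactCorrespondence (ReductionRel e) where
  exists_rel := h.reductionRel_exists
  retract := fun ⟨_, hq⟩ ⟨_, hq'⟩ H => hq.stableSummand hq' H
  pi := by
    intro J _ X N hXN
    choose q hq using hXN
    have hX : IsMCM B (ModuleCat.of B (∀ j, (X j).obj)) := by
      have := fun j => h.finite (X j)
      have := fun j => h.projective (X j)
      have := Fintype.ofFinite J
      classical
      exact (h.isMCM_iff _).2 ⟨inferInstance,
        .of_equiv (DFinsupp.linearEquivFunOnFintype (R := S) (M := fun j => (X j).obj))⟩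
    let Q : (∀ j, (X j).obj) →ₛₗ[reduction e] (∀ j, (N j).obj) :=
      { toFun := fun x j => q j (x j)
        map_add' := fun x y => by ext; simp
        map_smul' := fun b x => by ext; simp }
    have hQ : IsReduction Q := by
      refine ⟨fun y => ?_, fun x => ⟨fun hx => ?_, ?_⟩⟩
      · choose x hx using fun j => (hq j).surjective (y j)
        exact ⟨x, funext hx⟩
      · choose y hy using fun j => ((hq j).eq_zero_iff _).1 (congrFun hx j)
        exact ⟨y, funext hy⟩
      · rintro ⟨y, rfl⟩
        ext j
        exact ((hq j).eq_zero_iff _).2 ⟨y j, rfl⟩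
    exact ⟨hX, hQ.isMCM h hX, Q, hQ⟩
  shift := by
    rintro X M ξ M' ⟨q, hq⟩ hM'
    obtain ⟨ξ', -, rfl, -⟩ := h.exists_cosyzygy_reduction ξ hq hM'
    exact ⟨ξ', ⟨Iso.refl _⟩⟩
  star := by
    rintro X Y Z i p hi hp hip M M'' ⟨q, hq⟩ ⟨q'', hq''⟩
    obtain ⟨M', q', hq'⟩ := h.reductionRel_exists Y
    obtain ⟨ξ, b, hb⟩ := h.exists_cosyzygy_extension i p hi hp hip
    obtain ⟨K, hK⟩ := h.reductionRel_exists ξ.shift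
    obtain ⟨ξ', qF, -, hF, hι⟩ := h.exists_cosyzygy_reduction ξ hq hK
    obtain ⟨i', hi'⟩ := hq.exists_map q' i
    obtain ⟨p', hp'⟩ := hq'.exists_map q'' p
    obtain ⟨b', hb'⟩ := hq'.exists_map qF b
    have := h.projective Z
    obtain ⟨h₁, h₂, h₃⟩ := IsReduction.exact hq hq' hq'' (h.root_smul_injective Z.obj) hi hp hip
      hi' hp'
    refine ⟨M', ⟨q', hq'⟩, fun 𝒳 𝒴 => star_of_exact i' p' h₁ h₂ h₃ ξ' b'
      (hq.surjective.forall.2 fun x => ?_)⟩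
    rw [hi', hb', hb, hι]

end Reduction

/-! ## The cover functor -/

section Cover

open scoped QuadraticAlgebra

lemma FactorsThroughProjective.add {A : Type u} [CommRing A] {M N : Type u} [AddCommGroup M]
    [Module A M] [AddCommGroup N] [Module A N] {g h : M →ₗ[A] N} (hg : FactorsThroughProjective g)
    (hh : FactorsThroughProjective h) : FactorsThroughProjective (g + h) := by
  obtain ⟨P, _, _, a, b, _, _, rfl⟩ := hg
  obtain ⟨Q, _, _, c, d, _, _, rfl⟩ := hh
  exact ⟨P × Q, inferInstance, inferInstance, LinearMap.prod a c, LinearMap.coprod b d,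
    inferInstance, inferInstance, by ext; simp⟩

variable {S B : Type u} [CommRing S] [CommRing B] [Algebra S B] {f : S}

attribute [local instance low] restrictModule isScalarTower_restrictModule

lemma smul_eq_zero_of_quotient (M : Type u) [AddCommGroup M] [Module (S ⧸ Ideal.span {f}) M]
    [Module S M] [IsScalarTower S (S ⧸ Ideal.span {f}) M] (m : M) : f • m = 0 := by
  have : algebraMap S (S ⧸ Ideal.span {f}) f = 0 :=
    Ideal.Quotient.eq_zero_iff_mem.2 (Ideal.mem_span_singleton_self f)
  rw [← algebraMap_smul (S ⧸ Ideal.span {f}) f m, this, zero_smul]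

variable {N V M N' V' M' N'' V'' M'' : Type u}
  [AddCommGroup N] [Module B N] [Module S N] [IsScalarTower S B N]
  [AddCommGroup V] [Module S V]
  [AddCommGroup M] [Module (S ⧸ Ideal.span {f}) M] [Module S M]
  [IsScalarTower S (S ⧸ Ideal.span {f}) M]
  [AddCommGroup N'] [Module B N'] [Module S N'] [IsScalarTower S B N']
  [AddCommGroup V'] [Module S V']
  [AddCommGroup M'] [Module (S ⧸ Ideal.span {f}) M'] [Module S M']
  [IsScalarTower S (S ⧸ Ideal.span {f}) M']
  [AddCommGroup N''] [Module B N''] [Module S N''] [IsScalarTower S B N'']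
  [AddCommGroup V''] [Module S V'']
  [AddCommGroup M''] [Module (S ⧸ Ideal.span {f}) M''] [Module S M'']
  [IsScalarTower S (S ⧸ Ideal.span {f}) M'']

/-- `N` is the `B`-module of pairs `(v, w)` in `V × V` with `p v = 0`, where `p : V → M` is
surjective; the map `b` is the second coordinate. If `V` is projective over `S` then `N` is the
first syzygy of `M` over `B`. -/
structure IsCover (e : B ≃ₐ[S] QuadraticAlgebra S (-f) 0) (p : V →ₗ[S] M) (b : N →ₗ[S] V) :
    Prop where
  surjective : Function.Surjective p
  eq_zero : ∀ n, b n = 0 → b (root e • n) = 0 → n = 0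
  map_root : ∀ n, p (b (root e • n)) = 0
  exists_eq : ∀ v w, p v = 0 → ∃ n, b (root e • n) = v ∧ b n = w

variable {e : B ≃ₐ[S] QuadraticAlgebra S (-f) 0}

namespace IsCover

variable {p : V →ₗ[S] M} {b : N →ₗ[S] V} {p' : V' →ₗ[S] M'} {b' : N' →ₗ[S] V'}
  {p'' : V'' →ₗ[S] M''} {b'' : N'' →ₗ[S] V''}

lemma ext (hc : IsCover e p b) {n n' : N} (h : b n = b n')
    (h' : b (root e • n) = b (root e • n')) : n = n' :=
  sub_eq_zero.1 (hc.eq_zero _ (by simp [h]) (by simp [smul_sub, h']))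

/-- Coinduced property of the cover: a B-map into N is determined by its second coordinate g, since
the first must be g(y·); the condition says that this first coordinate lies in ker p. -/
lemma exists_lift {T : Type u} [AddCommGroup T] [Module B T] [Module S T] [IsScalarTower S B T]
    (hc : IsCover e p b) (g : T →ₗ[S] V) (hg : ∀ t, p (g (root e • t)) = 0) :
    ∃ h : T →ₗ[B] N, ∀ t, b (h t) = g t := by
  choose k hk₁ hk₂ using fun t => hc.exists_eq _ (g t) (hg t)
  let k' : T →ₗ[S] N :=
    { toFun := k
      map_add' := fun t t' => hc.ext (by simp [hk₂]) (by simp [hk₁, smul_add])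
      map_smul' := fun s t => hc.ext (by simp [hk₂]) (by simp [hk₁, smul_comm (root e) s]) }
  refine ⟨ofCommutes e k' fun t => hc.ext ?_ ?_, hk₂⟩
  · exact (hk₂ _).trans (hk₁ t).symm
  · refine (hk₁ _).trans ?_
    rw [root_smul_root_smul, root_smul_root_smul, map_neg, map_neg, map_smul, map_smul]
    congr 2
    exact (hk₂ t).symm

lemma hom_ext {T : Type u} [AddCommGroup T] [Module B T] (hc : IsCover e p b) {g h : T →ₗ[B] N}
    (H : ∀ t, b (g t) = b (h t)) : g = h :=
  LinearMap.ext fun t => hc.ext (H t) (by rw [← map_smul, H, map_smul])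

/-- The standard cover. -/
def coverModule (e : B ≃ₐ[S] QuadraticAlgebra S (-f) 0) (p : V →ₗ[S] M) :
    Submodule B (Dbl e V) where
  carrier := {z | p (Dbl.fst e z) = 0}
  add_mem' {z w} hz hw := by simp_all
  zero_mem' := by simp
  smul_mem' b z hz := by
    simp_all [Dbl.fst_smul, mul_smul, smul_eq_zero_of_quotient]

lemma coverModule_isCover (hp : Function.Surjective p) :
    IsCover e p (Dbl.snd e ∘ₗ (coverModule e p).subtype.restrictScalars S) where
  surjective := hp
  eq_zero n h h' := Subtype.ext (Dbl.ext (by simpa using h') (by simpa using h))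
  map_root n := by
    have : p (Dbl.fst e n.1) = 0 := n.2
    simpa using this
  exists_eq v w hv := ⟨⟨Dbl.mk e v w, hv⟩, by simp, by simp⟩

lemma finite_projective (h : IsDoubleCover e) [Module.Finite S V] [Module.Projective S V]
    (hc : IsCover e p b) (hM : IsMCM _ (ModuleCat.of (S ⧸ Ideal.span {f}) M)) :
    Module.Finite S N ∧ Module.Projective S N := by
  have := h.isNoetherianRing
  have := (h.isMCM_quotient_iff M V p hc.surjective).1 hM
  let g : N →ₗ[S] LinearMap.ker p × V :=
    LinearMap.prod (LinearMap.codRestrict _ (b ∘ₗ Algebra.lsmul S S N (root e)) hc.map_root) b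
  have hg : Function.Bijective g := by
    refine ⟨fun n n' hn => ?_, fun ⟨⟨v, hv⟩, w⟩ => ?_⟩
    · obtain ⟨h₁, h₂⟩ := Prod.ext_iff.1 hn
      exact hc.ext h₂ (congrArg Subtype.val h₁)
    · obtain ⟨n, h₁, h₂⟩ := hc.exists_eq v w hv
      exact ⟨n, Prod.ext (Subtype.ext h₁) h₂⟩
  let E := LinearEquiv.ofBijective g hg
  exact ⟨Module.Finite.equiv E.symm, Module.Projective.of_equiv E.symm⟩

lemma isMCM (h : IsDoubleCover e) [Module.Finite S V] [Module.Projective S V]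
    (hc : IsCover e p b) (hM : IsMCM _ (ModuleCat.of (S ⧸ Ideal.span {f}) M)) :
    IsMCM B (ModuleCat.of B N) :=
  (h.isMCM_iff N).2 (hc.finite_projective h hM)

/-- Take κ(x) = -a(b(yx))/f. The division is possible because b(yx) lies in ker p, and y² = -f gives
κ(yx) = a(b x). It serves to factor the cover of a map through a free module. -/
lemma exists_root_desc (h : IsDoubleCover e) (hc : IsCover e p b) {n : ℕ}
    (a : V →ₗ[S] (Fin n → S))
    (ha : ∀ v, p v = 0 → ∀ j, Ideal.Quotient.mk (Ideal.span {f}) (a v j) = 0) :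
    ∃ κ : N →ₗ[S] (Fin n → S), ∀ x, κ (root e • x) = a (b x) := by
  have key : ∀ x, ∃ y : Fin n → S, f • y = - a (b (root e • x)) := by
    intro x
    have : ∀ j, ∃ s, a (b (root e • x)) j = f * s := fun j =>
      Ideal.mem_span_singleton.1 (Ideal.Quotient.eq_zero_iff_mem.1 (ha _ (hc.map_root x) j))
    choose s hs using this
    exact ⟨-s, by ext j; simp [hs]⟩
  choose κ hκ using key
  have hinj := h.smul_injective (Fin n → S)
  refine ⟨{ toFun := κ, map_add' := fun x y => hinj ?_, map_smul' := fun s x => hinj ?_ },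
    fun x => hinj ?_⟩
  · simp only [smul_add, hκ, map_add, neg_add]
  · simp only [smul_comm f, hκ, smul_comm (root e) s, map_smul, RingHom.id_apply, smul_neg]
  · change f • κ (root e • x) = f • a (b x)
    rw [hκ, root_smul_root_smul, map_neg, map_neg, map_smul, map_smul, neg_neg]

/-- Lift all maps between the modules to the projective S-modules above them. The resulting defect
of the retraction on covers has two parts, one from the free module in the stable identity and one
from the ambiguity of the lifts; each factors through an induced module. -/
lemma stableSummand (h : IsDoubleCover e) [Module.Finite S V] [Module.Projective S V]
    [Module.Projective S V'] (hc : IsCover e p b) (hc' : IsCover e p' b')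
    (H : StableSummand (A := S ⧸ Ideal.span {f}) M M') : StableSummand (A := B) N N' := by
  obtain ⟨i, r, E, _, _, a, c, _, _, hE⟩ := H
  obtain ⟨n, g, s, -, -, hgs⟩ :=
    Module.Finite.exists_comp_eq_id_of_projective (S ⧸ Ideal.span {f}) E
  have hgs' : ∀ x, g (s x) = x := LinearMap.congr_fun hgs
  have hE' : ∀ m, m - r (i m) = c (a m) := LinearMap.congr_fun hE
  let π : (Fin n → S) →ₗ[S] (Fin n → S ⧸ Ideal.span {f}) :=
    (Algebra.linearMap S (S ⧸ Ideal.span {f})).compLeft (Fin n)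
  have hπ : Function.Surjective π := fun x => by
    choose y hy using fun j => Ideal.Quotient.mk_surjective (x j)
    exact ⟨y, funext hy⟩
  obtain ⟨i₁, hi₁⟩ := Module.projective_lifting_property p' (i.restrictScalars S ∘ₗ p)
    hc'.surjective
  obtain ⟨r₁, hr₁⟩ := Module.projective_lifting_property p (r.restrictScalars S ∘ₗ p')
    hc.surjective
  obtain ⟨a₁, ha₁⟩ := Module.projective_lifting_property π ((s ∘ₗ a).restrictScalars S ∘ₗ p) hπ
  obtain ⟨c₁, hc₁⟩ := Module.projective_lifting_property p ((c ∘ₗ g).restrictScalars S ∘ₗ π)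
    hc.surjective
  replace hi₁ : ∀ v, p' (i₁ v) = i (p v) := LinearMap.congr_fun hi₁
  replace hr₁ : ∀ v, p (r₁ v) = r (p' v) := LinearMap.congr_fun hr₁
  replace ha₁ : ∀ v, π (a₁ v) = s (a (p v)) := LinearMap.congr_fun ha₁
  replace hc₁ : ∀ v, p (c₁ v) = c (g (π v)) := LinearMap.congr_fun hc₁
  -- The discrepancy of the lifts: the identity id - ri = ca holds only on M, so D takes values in
  -- ker p.
  let D : V →ₗ[S] V := LinearMap.id - r₁ ∘ₗ i₁ - c₁ ∘ₗ a₁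
  have hD : ∀ v, p (D v) = 0 := fun v => by
    simp [D, hi₁, hr₁, ha₁, hc₁, hgs', ← hE']
  obtain ⟨iN, hiN⟩ := hc'.exists_lift (i₁ ∘ₗ b) fun t => by simp [hi₁, hc.map_root]
  obtain ⟨rN, hrN⟩ := hc.exists_lift (r₁ ∘ₗ b') fun t => by simp [hr₁, hc'.map_root]
  obtain ⟨κ, hκ⟩ := hc.exists_root_desc h a₁ fun v hv j => by
    have := congrFun (ha₁ v) j
    rw [hv, map_zero, map_zero] at this
    exact this
  -- Allowed since the first coordinate of yz is a multiple of f, and f kills M. With `κ` this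
  -- factors the c₁a₁ part through `Dbl e (Fin n → S)`.
  obtain ⟨u₁, hu₁⟩ := hc.exists_lift (c₁ ∘ₗ Dbl.fst e) fun t => by
    simp [smul_eq_zero_of_quotient (f := f) M]
  -- Allowed since D lands in ker p. This factors the D part through `Dbl e V`.
  obtain ⟨u₂, hu₂⟩ := hc.exists_lift (D ∘ₗ Dbl.snd e) fun t => by simp [hD]
  refine ⟨iN, rN, ?_⟩
  have : LinearMap.id - rN ∘ₗ iN = u₁ ∘ₗ Dbl.lift e κ + u₂ ∘ₗ Dbl.lift e b :=
    hc.hom_ext fun t => by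
      simp [hrN, hiN, hu₁, hu₂, hκ, D]
  rw [this]
  exact .add ⟨Dbl e (Fin n → S), inferInstance, inferInstance, _, _, inferInstance, inferInstance,
    rfl⟩ ⟨Dbl e V, inferInstance, inferInstance, _, _, inferInstance, inferInstance, rfl⟩

/-- A projective M is a stable summand of zero, whose cover may be taken to be zero. Hence the
identity of N factors through a finitely generated projective. -/
lemma finite_projective_of_projective (h : IsDoubleCover e) [Module.Finite S V]
    [Module.Projective S V] (hc : IsCover e p b) [Module.Finite (S ⧸ Ideal.span {f}) M]
    [Module.Projective (S ⧸ Ideal.span {f}) M] : Module.Finite B N ∧ Module.Projective B N := by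
  have h0 : IsCover e (M := PUnit) (N := PUnit) (V := PUnit) 0 0 :=
    ⟨fun _ => ⟨0, rfl⟩, fun _ _ _ => rfl, fun _ => rfl, fun _ _ _ => ⟨0, rfl, rfl⟩⟩
  obtain ⟨i, r, P, _, _, a, c, _, _, hP⟩ := hc.stableSummand h h0
    ⟨0, 0, M, inferInstance, inferInstance, LinearMap.id, LinearMap.id, inferInstance,
      inferInstance, by simp⟩
  have hca : c ∘ₗ a = LinearMap.id := by
    rw [← hP, sub_eq_self]
    ext x
    exact (congrArg r (Subsingleton.elim (i x) 0)).trans (map_zero r)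
  exact ⟨Module.Finite.of_surjective c fun x => ⟨a x, LinearMap.congr_fun hca x⟩,
    .of_split a c hca⟩

/-- The horseshoe lemma for covers. -/
lemma exists_exact [Module.Projective S V''] (hc : IsCover e p b) (hc'' : IsCover e p'' b'')
    (i : M →ₗ[S ⧸ Ideal.span {f}] M') (π : M' →ₗ[S ⧸ Ideal.span {f}] M'')
    (hi : Function.Injective i) (hπ : Function.Surjective π) (hiπ : Function.Exact i π) :
    ∃ (K : Type u) (_ : AddCommGroup K) (_ : Module B K) (_ : Module S K)
      (_ : IsScalarTower S B K) (pK : V × V'' →ₗ[S] M') (bK : K →ₗ[S] V × V'') (iK : N →ₗ[B] K)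
      (πK : K →ₗ[B] N''), IsCover e pK bK ∧ Function.Injective iK ∧ Function.Surjective πK ∧
        Function.Exact iK πK := by
  obtain ⟨l, hl⟩ := Module.projective_lifting_property (π.restrictScalars S) p'' hπ
  replace hl : ∀ v, π (l v) = p'' v := LinearMap.congr_fun hl
  let pK : V × V'' →ₗ[S] M' := LinearMap.coprod (i.restrictScalars S ∘ₗ p) l
  have hpK : ∀ v w, pK (v, w) = i (p v) + l w := fun _ _ => rfl
  have hi0 : ∀ x, π (i x) = 0 := hiπ.apply_apply_eq_zero
  have hπK : ∀ x, π (pK x) = p'' x.2 := fun x => by simp [pK, hi0, hl]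
  -- The kernel of `pK` surjects onto the kernel of `p''`; this makes `πK` surjective.
  have key : ∀ w, p'' w = 0 → ∃ v, pK (v, w) = 0 := fun w hw => by
    obtain ⟨x, hx⟩ := (hiπ (l w)).1 (by rw [hl, hw])
    obtain ⟨v, rfl⟩ := hc.surjective x
    exact ⟨-v, by simp [hpK, hx]⟩
  have hsurj : Function.Surjective pK := fun m => by
    obtain ⟨w, hw⟩ := hc''.surjective (π m)
    obtain ⟨x, hx⟩ := (hiπ (m - l w)).1 (by simp [hl, hw])
    obtain ⟨v, rfl⟩ := hc.surjective x
    exact ⟨(v, w), by simp [hpK, hx]⟩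
  have hK := coverModule_isCover (e := e) hsurj
  generalize Dbl.snd e ∘ₗ (coverModule e pK).subtype.restrictScalars S = bK at hK
  obtain ⟨iK, hiK⟩ := hK.exists_lift (LinearMap.inl S V V'' ∘ₗ b) fun t => by
    simp [hpK, hc.map_root]
  obtain ⟨πK, hπK'⟩ := hc''.exists_lift (LinearMap.snd S V V'' ∘ₗ bK) fun t => by
    rw [LinearMap.comp_apply, LinearMap.snd_apply, ← hπK, hK.map_root, map_zero]
  have hiK' : ∀ n, b n = (bK (iK n)).1 := fun n => by rw [hiK]; rfl
  refine ⟨_, _, _, _, inferInstance, pK, bK, iK, πK, hK, ?_, fun n => ?_, fun k => ⟨fun hk => ?_, ?_⟩⟩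
  · refine (injective_iff_map_eq_zero iK).2 fun n hn => hc.eq_zero n ?_ ?_
    · rw [hiK', hn, map_zero, Prod.fst_zero]
    · rw [hiK', map_smul, hn, smul_zero, map_zero, Prod.fst_zero]
  · obtain ⟨v, hv⟩ := key _ (hc''.map_root n)
    obtain ⟨k, hk₁, hk₂⟩ := hK.exists_eq _ (0, b'' n) hv
    refine ⟨k, hc''.ext ?_ ?_⟩
    · rw [hπK', LinearMap.comp_apply, hk₂, LinearMap.snd_apply]
    · rw [← map_smul, hπK', LinearMap.comp_apply, hk₁, LinearMap.snd_apply]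
  · have h₁ : (bK k).2 = 0 := by
      have := hπK' k
      rw [hk, map_zero] at this
      exact this.symm
    have h₂ : (bK (root e • k)).2 = 0 := by
      have := hπK' (root e • k)
      rw [map_smul, hk, smul_zero, map_zero] at this
      exact this.symm
    have h₃ : p (bK (root e • k)).1 = 0 := hi (by
      have : pK ((bK (root e • k)).1, (bK (root e • k)).2) = 0 := hK.map_root k
      rw [h₂, hpK, map_zero, add_zero] at this
      rw [this, map_zero])
    obtain ⟨n, hn₁, hn₂⟩ := hc.exists_eq _ (bK k).1 h₃
    refine ⟨n, hK.ext ?_ ?_⟩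
    · rw [hiK]
      exact Prod.ext hn₂ h₁.symm
    · rw [← map_smul, hiK]
      exact Prod.ext hn₁ h₂.symm
  · rintro ⟨n, rfl⟩
    refine hc''.eq_zero _ ?_ ?_
    · rw [hπK', LinearMap.comp_apply, hiK]
      rfl
    · rw [← map_smul, ← map_smul, hπK', LinearMap.comp_apply, hiK]
      rfl

end IsCover

/-- `N` is a cover of `M`. -/
def CoverRel (e : B ≃ₐ[S] QuadraticAlgebra S (-f) 0) (M : CM (S ⧸ Ideal.span {f})) (N : CM B) :
    Prop :=
  ∃ (V : Type u) (_ : AddCommGroup V) (_ : Module S V) (p : V →ₗ[S] M.obj) (b : N.obj →ₗ[S] V),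
    Module.Finite S V ∧ Module.Projective S V ∧ IsCover e p b

lemma IsCover.coverRel_of_equiv [Module.Finite S V] [Module.Projective S V] {p : V →ₗ[S] M}
    {b : N →ₗ[S] V} (hc : IsCover e p b) {X : CM (S ⧸ Ideal.span {f})} {Y : CM B}
    (E : M ≃ₗ[S ⧸ Ideal.span {f}] X.obj) (E' : Y.obj ≃ₗ[B] N) : CoverRel e X Y := by
  refine ⟨V, _, _, E.toLinearMap.restrictScalars S ∘ₗ p, b ∘ₗ E'.toLinearMap.restrictScalars S,
    inferInstance, inferInstance, E.surjective.comp hc.surjective, fun n h₁ h₂ => ?_, fun n => ?_,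
    fun v w hv => ?_⟩
  · refine E'.map_eq_zero_iff.1 (hc.eq_zero _ h₁ ?_)
    simpa using h₂
  · simp [hc.map_root]
  · obtain ⟨n, h₁, h₂⟩ := hc.exists_eq v w (by simpa using hv)
    exact ⟨E'.symm n, by simpa using h₁, by simpa using h₂⟩

lemma IsCover.coverRel [Module.Finite S V] [Module.Projective S V] {p : V →ₗ[S] M}
    {b : N →ₗ[S] V} (hc : IsCover e p b)
    (hM : IsMCM _ (ModuleCat.of (S ⧸ Ideal.span {f}) M)) (hN : IsMCM B (ModuleCat.of B N)) :
    CoverRel e (cmOf M hM) (cmOf N hN) :=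
  hc.coverRel_of_equiv (LinearEquiv.refl (S ⧸ Ideal.span {f}) M) (LinearEquiv.refl B N)

/-- Extensions are transported by the horseshoe lemma. Applied to a cosyzygy sequence it has a
projective middle term over B, so it is again a cosyzygy sequence. -/
theorem IsDoubleCover.isExactCorrespondence_coverRel (h : IsDoubleCover e) :
    IsExactCorrespondence (CoverRel e) where
  exists_rel M := by
    have := M.property.1
    have : Module.Finite S M.obj := .trans (S ⧸ Ideal.span {f}) _
    obtain ⟨n, p, hp⟩ := Module.Finite.exists_fin' S M.obj
    have hc := IsCover.coverModule_isCover (e := e) hp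
    exact ⟨_, hc.coverRel M.property (hc.isMCM h M.property)⟩
  retract := fun ⟨_, _, _, _, _, _, _, hc⟩ ⟨_, _, _, _, _, _, _, hc'⟩ H => hc.stableSummand h hc' H
  pi := by
    intro J _ X N hXN
    choose V _ _ p b _ _ hc using hXN
    have := Fintype.ofFinite J
    classical
    have : Module.Projective S (∀ j, V j) :=
      .of_equiv (DFinsupp.linearEquivFunOnFintype (R := S) (M := V))
    let p' : (∀ j, V j) →ₗ[S] (∀ j, (X j).obj) := LinearMap.pi fun j => p j ∘ₗ LinearMap.proj j
    let b' : (∀ j, (N j).obj) →ₗ[S] (∀ j, V j) := LinearMap.pi fun j => b j ∘ₗ LinearMap.proj j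
    have hc' : IsCover e p' b' := by
      refine ⟨fun x => ?_, fun n hn hn' => ?_, fun n => ?_, fun v w hv => ?_⟩
      · choose v hv using fun j => (hc j).surjective (x j)
        exact ⟨v, funext hv⟩
      · exact funext fun j => (hc j).eq_zero _ (congrFun hn j) (congrFun hn' j)
      · exact funext fun j => (hc j).map_root _
      · choose n hn hn' using fun j => (hc j).exists_eq (v j) (w j) (congrFun hv j)
        exact ⟨n, funext hn, funext hn'⟩
    have hX : IsMCM _ (ModuleCat.of (S ⧸ Ideal.span {f}) (∀ j, (X j).obj)) := by
      rw [h.isMCM_quotient_iff _ _ p' hc'.surjective]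
      have := fun j => (h.isMCM_quotient_iff _ _ (p j) (hc j).surjective).1 (X j).property
      let E : LinearMap.ker p' ≃ₗ[S] ∀ j, LinearMap.ker (p j) :=
        { toFun := fun v j => ⟨v.1 j, congrFun v.2 j⟩
          invFun := fun v => ⟨fun j => (v j).1, funext fun j => (v j).2⟩
          map_add' := fun _ _ => rfl
          map_smul' := fun _ _ => rfl
          left_inv := fun _ => rfl
          right_inv := fun _ => rfl }
      have : Module.Projective S (∀ j, LinearMap.ker (p j)) :=
        .of_equiv (DFinsupp.linearEquivFunOnFintype (R := S) (M := fun j => LinearMap.ker (p j)))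
      exact .of_equiv E.symm
    exact ⟨hX, hc'.isMCM h hX, hc'.coverRel _ _⟩
  shift := by
    rintro X N ξ N' ⟨V, _, _, p, b, _, _, hc⟩ ⟨V', _, _, p', b', _, _, hc'⟩
    obtain ⟨h₁, h₂, h₃⟩ := ξ.exact
    obtain ⟨K, _, _, _, _, pK, bK, iK, πK, hK, h₁', h₂', h₃'⟩ :=
      hc.exists_exact hc' ξ.ι.hom ξ.π.hom h₁ h₂ h₃
    have := ξ.finite
    have := ξ.projective
    obtain ⟨hf, hp⟩ := hK.finite_projective_of_projective h
    exact ⟨Cosyzygy.of (Z := N') hf hp iK πK h₁' h₂' h₃', ⟨Iso.refl _⟩⟩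
  star := by
    rintro X Y Z i p hi hp hip N N'' ⟨V, _, _, p₁, b₁, _, _, hc⟩ ⟨V'', _, _, p₂, b₂, _, _, hc''⟩
    obtain ⟨K, _, _, _, _, pK, bK, iK, πK, hK, h₁', h₂', h₃'⟩ :=
      hc.exists_exact hc'' i p hi hp hip
    let N' : CM B := cmOf K (hK.isMCM h Y.property)
    refine ⟨N', hK.coverRel Y.property _, fun 𝒳 𝒴 => ?_⟩
    obtain ⟨ξ, b, hb⟩ := h.exists_cosyzygy_extension (Y := N') (Z := N'') iK πK h₁' h₂' h₃'
    exact star_of_exact (Y := N') iK πK h₁' h₂' h₃' ξ b hb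

end Cover

/-! ## Comparison of the generation times -/

section Comparison

open scoped QuadraticAlgebra

attribute [local instance low] restrictModule isScalarTower_restrictModule

variable {S B : Type u} [CommRing S] [CommRing B] [Algebra S B] {f : S}
  {e : B ≃ₐ[S] QuadraticAlgebra S (-f) 0}

/-- The cover of the reduction of `N` is the direct sum of `N` and its twist. -/
lemma IsCover.nonempty_linearEquiv {N N' M : Type u}
    [AddCommGroup N] [Module B N] [Module S N] [IsScalarTower S B N]
    [AddCommGroup N'] [Module B N'] [Module S N'] [IsScalarTower S B N']
    [AddCommGroup M] [Module (S ⧸ Ideal.span {f}) M] [Module S M]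
    [IsScalarTower S (S ⧸ Ideal.span {f}) M] [Module.Projective S N] (h : IsDoubleCover e)
    {p : N →ₗ[S] M} {b : N' →ₗ[S] N} (hc : IsCover e p b)
    (hp : ∀ n, p n = 0 ↔ ∃ n', n = root e • n') : Nonempty (N' ≃ₗ[B] N × Twist e N) := by
  -- The map (n, m) ↦ n + m. Since y acts on the twist by -y, it sends y(n, m) to y(n - m), which
  -- lies in yN = ker p; so it lifts to the cover.
  let g : N × Twist e N →ₗ[S] N := LinearMap.coprod LinearMap.id (toTwist e).symm.toLinearMap
  have hg : ∀ n m, g (n, toTwist e m) = n + m := fun _ _ => rfl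
  have hg' : ∀ n m, g (root e • (n, toTwist e m)) = root e • (n - m) := fun n m => by
    rw [Prod.smul_mk, root_smul_toTwist, ← map_neg, hg, smul_sub, sub_eq_add_neg]
  obtain ⟨t, ht⟩ := hc.exists_lift g fun x => by
    obtain ⟨n, m⟩ := x
    obtain ⟨m, rfl⟩ := (toTwist e).surjective m
    rw [hg', hp]
    exact ⟨_, rfl⟩
  have ht₁ : ∀ n m, b (t (n, toTwist e m)) = n + m := fun n m => (ht _).trans (hg n m)
  have ht₂ : ∀ n m, b (root e • t (n, toTwist e m)) = root e • (n - m) := fun n m => by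
    rw [← map_smul, ht, hg']
  obtain ⟨u, hu⟩ := h.isUnit_two.exists_right_inv
  have hu' : ∀ n : N, u • (n + n) = n := fun n => by
    rw [← two_smul S n, smul_smul, mul_comm, hu, one_smul]
  refine ⟨(LinearEquiv.ofBijective t ⟨(injective_iff_map_eq_zero t).2 ?_, fun x => ?_⟩).symm⟩
  · rintro ⟨n, m⟩ h0
    obtain ⟨m, rfl⟩ := (toTwist e).surjective m
    have h₁ := ht₁ n m
    have h₂ := ht₂ n m
    rw [h0, map_zero] at h₁
    rw [h0, smul_zero, map_zero] at h₂
    have h₃ : n - m = 0 := h.root_smul_injective N (h₂.symm.trans (smul_zero _).symm)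
    obtain rfl := sub_eq_zero.1 h₃
    have : n = 0 := by rw [← hu' n, ← h₁, smul_zero]
    rw [this, map_zero]
    rfl
  · obtain ⟨k, hk⟩ := (hp _).1 (hc.map_root x)
    -- Solve n + m = b x and n - m = k, where b(yx) = yk; u is the inverse of 2.
    refine ⟨(u • (b x + k), toTwist e (u • (b x - k))), hc.ext ?_ ?_⟩
    · rw [ht₁, ← smul_add]
      conv_rhs => rw [← hu' (b x)]
      congr 1
      abel
    · rw [ht₂, ← smul_sub, hk]
      congr 1
      conv_rhs => rw [← hu' k]
      congr 1
      abel

/-- N is projective over S, so the quotient map N → N/yN can itself be used to form the cover. The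
extra summand is the twist of N, its cosyzygy, which lies in ⟨N⟩. -/
lemma IsDoubleCover.exists_reductionRel_coverRel (h : IsDoubleCover e) (N : CM B) :
    ∃ M N', ReductionRel e N M ∧ CoverRel e M N' ∧ StableSummand (A := B) N.obj N'.obj ∧
      gen (fun X => X = stab N) (stab N') := by
  obtain ⟨M, q, hq⟩ := h.reductionRel_exists N
  have := h.finite N
  have := h.projective N
  let p : N.obj →ₗ[S] M.obj :=
    { toFun := q
      map_add' := map_add q
      map_smul' := fun s n => by
        rw [← algebraMap_smul B s n, map_smulₛₗ, reduction_algebraMap]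
        rfl }
  have hc := IsCover.coverModule_isCover (e := e) (p := p) hq.surjective
  obtain ⟨E⟩ := hc.nonempty_linearEquiv h hq.eq_zero_iff
  refine ⟨M, _, ⟨q, hq⟩, hc.coverRel M.property (hc.isMCM h M.property),
    .of_leftInverse (E.symm.toLinearMap ∘ₗ LinearMap.inl B _ _)
      (LinearMap.fst B _ _ ∘ₗ E.toLinearMap) fun x => by simp, ?_⟩
  have hcl := isSumSummandShiftClosed_gen (fun X => X = stab N)
  have hN := le_gen (fun X => X = stab N) _ rfl
  exact prop_of_linearEquiv_prod hcl (X := N) (Y := (h.cosyzygy N).shift) E hN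
    ((hcl.shifts _ _ ⟨h.cosyzygy N, ⟨Iso.refl _⟩⟩).1 hN)

/-- The reduction of the cover of `M` is the direct sum of `M` and its syzygy. -/
lemma IsDoubleCover.exists_coverRel_reductionRel (h : IsDoubleCover e)
    (M : CM (S ⧸ Ideal.span {f})) :
    ∃ N M', CoverRel e M N ∧ ReductionRel e N M' ∧
      StableSummand (A := S ⧸ Ideal.span {f}) M.obj M'.obj ∧
      gen (fun X => X = stab M) (stab M') := by
  have := M.property.1
  have := h.isNoetherianRing
  obtain ⟨n, r, hr⟩ := Module.Finite.exists_fin' (S ⧸ Ideal.span {f}) M.obj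
  let π : (Fin n → S) →ₗ[S] (Fin n → S ⧸ Ideal.span {f}) :=
    (Algebra.linearMap S (S ⧸ Ideal.span {f})).compLeft (Fin n)
  have hπ : Function.Surjective π := fun x => by
    choose y hy using fun j => Ideal.Quotient.mk_surjective (x j)
    exact ⟨y, funext hy⟩
  have hπ0 : ∀ x, π x = 0 ↔ ∃ y, x = f • y := fun x => by
    constructor
    · intro hx
      choose y hy using fun j => Ideal.mem_span_singleton.1
        (Ideal.Quotient.eq_zero_iff_mem.1 (congrFun hx j))
      exact ⟨y, funext hy⟩
    · rintro ⟨y, rfl⟩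
      rw [map_smul, smul_eq_zero_of_quotient]
  -- Presenting M over S through a free S/(f)-module makes the syzygy ker r of M over S/(f) visible
  -- in the reduction of the cover.
  let p : (Fin n → S) →ₗ[S] M.obj := r.restrictScalars S ∘ₗ π
  have hp : Function.Surjective p := hr.comp hπ
  have hc := IsCover.coverModule_isCover (e := e) hp
  have hN := hc.isMCM h M.property
  generalize Dbl.snd e ∘ₗ (IsCover.coverModule e p).subtype.restrictScalars S = b at hc
  -- The pair (v, w) goes to (p w, π v). It dies exactly when p w = 0 and v is a multiple of f,
  -- which describes y times the cover.
  let q : IsCover.coverModule e p →ₛₗ[reduction e] M.obj × LinearMap.ker r :=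
    { toFun := fun x => (p (b x), ⟨π (b (root e • x)), hc.map_root x⟩)
      map_add' := fun x y => by
        refine Prod.ext ?_ (Subtype.ext ?_)
        · simp
        · simp [smul_add]
      map_smul' := fun t x => by
        have hs : ∀ (s : S) {K : Type u} [AddCommGroup K] [Module (S ⧸ Ideal.span {f}) K]
          [Module S K] [IsScalarTower S (S ⧸ Ideal.span {f}) K] (k : K),
          Ideal.Quotient.mk (Ideal.span {f}) s • k = s • k := fun s _ _ _ _ _ k =>
            algebraMap_smul (S ⧸ Ideal.span {f}) s k
        have h₁ : b (t • x) = (e t).re • b x + (e t).im • b (root e • x) := by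
          rw [smul_eq e t x, map_add, map_smul, map_smul]
        have h₂ : b (root e • t • x) =
            (e t).re • b (root e • x) - (f * (e t).im) • b x := by
          rw [smul_eq e t x, smul_add, smul_comm (root e), smul_comm (root e),
            root_smul_root_smul, map_add, map_smul b (e t).re, map_smul b (e t).im, map_neg,
            map_smul b f]
          module
        refine Prod.ext ?_ (Subtype.ext ?_)
        · change p (b (t • x)) = reduction e t • p (b x)
          rw [h₁, map_add, map_smul, map_smul, hc.map_root, smul_zero, add_zero,
            reduction_apply, hs]
        · change π (b (root e • t • x)) = reduction e t • π (b (root e • x))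
          rw [h₂, map_sub, map_smul π (e t).re, mul_smul, map_smul π f,
            smul_eq_zero_of_quotient (f := f), sub_zero,
            reduction_apply, hs] }
  have hq : IsReduction q := by
    refine ⟨fun ⟨m, k⟩ => ?_, fun x => ⟨fun hx => ?_, ?_⟩⟩
    · obtain ⟨w, rfl⟩ := hp m
      obtain ⟨v, hv⟩ := hπ k
      obtain ⟨x, hx₁, hx₂⟩ := hc.exists_eq v w ((congrArg r hv).trans k.2)
      exact ⟨x, Prod.ext (congrArg p hx₂) (Subtype.ext ((congrArg π hx₁).trans hv))⟩
    · obtain ⟨h₁, h₂⟩ := Prod.ext_iff.1 hx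
      obtain ⟨v, hv⟩ := (hπ0 _).1 (congrArg Subtype.val h₂)
      obtain ⟨y, hy₁, hy₂⟩ := hc.exists_eq (b x) (-v) h₁
      refine ⟨y, hc.ext hy₁.symm ?_⟩
      rw [hv, root_smul_root_smul, map_neg, map_smul, hy₂, smul_neg, neg_neg]
    · rintro ⟨y, rfl⟩
      refine Prod.ext (hc.map_root y) (Subtype.ext ((hπ0 _).2 ⟨- b y, ?_⟩))
      rw [root_smul_root_smul, map_neg, map_smul, smul_neg]
  -- The projective S-module ker p maps onto ker r with kernel f Sⁿ ≅ Sⁿ.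
  have hK : IsMCM _ (ModuleCat.of (S ⧸ Ideal.span {f}) (LinearMap.ker r)) := by
    have := (h.isMCM_quotient_iff M.obj _ p hp).1 M.property
    let π' : LinearMap.ker p →ₗ[S] LinearMap.ker r :=
      { toFun := fun v => ⟨π v, v.2⟩
        map_add' := fun v w => Subtype.ext (map_add π v.1 w.1)
        map_smul' := fun s v => Subtype.ext (map_smul π s v.1) }
    have hπ' : Function.Surjective π' := fun k => by
      obtain ⟨v, hv⟩ := hπ k
      exact ⟨⟨v, (congrArg r hv).trans k.2⟩, Subtype.ext hv⟩
    rw [h.isMCM_quotient_iff _ _ π' hπ']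
    have hp0 : ∀ v, p (f • v) = 0 := fun v => by rw [map_smul, smul_eq_zero_of_quotient]
    let j : (Fin n → S) →ₗ[S] LinearMap.ker π' := LinearMap.codRestrict _
      (LinearMap.codRestrict _ (Algebra.lsmul S S _ f) hp0)
      fun v => Subtype.ext ((hπ0 _).2 ⟨v, rfl⟩)
    refine .of_equiv (LinearEquiv.ofBijective j ⟨fun v w hvw => ?_, fun x => ?_⟩)
    · exact h.smul_injective _ (congrArg (fun z => z.1.1) hvw)
    · obtain ⟨v, hv⟩ := (hπ0 _).1 (congrArg Subtype.val x.2)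
      exact ⟨v, Subtype.ext (Subtype.ext hv.symm)⟩
  refine ⟨_, cmOf _ (hq.isMCM h hN), hc.coverRel M.property hN, ⟨q, hq⟩,
    .of_leftInverse (LinearMap.inl _ _ _) (LinearMap.fst _ _ _) fun _ => rfl, ?_⟩
  have hcl := isSumSummandShiftClosed_gen (fun X => X = stab M)
  have hM := le_gen (fun X => X = stab M) _ rfl
  let ξ : Cosyzygy (cmOf _ hK) := Cosyzygy.of (Z := M) inferInstance inferInstance
    (LinearMap.ker r).subtype r Subtype.val_injective hr (LinearMap.exact_subtype_ker_map r)
  exact prop_of_linearEquiv_prod hcl (X := M) (Y := cmOf _ hK)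
    (LinearEquiv.refl (S ⧸ Ideal.span {f}) (M.obj × LinearMap.ker r)) hM
    ((hcl.shifts _ _ ⟨ξ, ⟨Iso.refl _⟩⟩).2 hM)

namespace IsDoubleCover

lemma genIter_eq_top_of_reductionRel (h : IsDoubleCover e) {N : CM B}
    {M : CM (S ⧸ Ideal.span {f})} (hNM : ReductionRel e N M) {n : ℕ}
    (hN : genIter (fun X => X = stab N) (n + 1) = ⊤) :
    genIter (fun X => X = stab M) (n + 1) = ⊤ :=
  h.isExactCorrespondence_reductionRel.genIter_eq_top hNM hN fun K =>
    let ⟨X, K', _, h₁, h₂, _⟩ := h.exists_coverRel_reductionRel K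
    ⟨X, K', h₁, h₂⟩

lemma genIter_eq_top_of_coverRel (h : IsDoubleCover e) {N : CM B}
    {M : CM (S ⧸ Ideal.span {f})} (hMN : CoverRel e M N) {n : ℕ}
    (hM : genIter (fun X => X = stab M) (n + 1) = ⊤) :
    genIter (fun X => X = stab N) (n + 1) = ⊤ :=
  h.isExactCorrespondence_coverRel.genIter_eq_top hMN hM fun K =>
    let ⟨X, K', _, h₁, h₂, _⟩ := h.exists_reductionRel_coverRel K
    ⟨X, K', h₁, h₂⟩

/-- The cover N generates at least as fast as M, its reduction M' at least as fast as N, and M' ∈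
⟨M⟩ no faster than M, so all three agree. -/
lemma exists_generationTime_eq (h : IsDoubleCover e) (M : StableCM (S ⧸ Ideal.span {f})) :
    ∃ N : StableCM B, generationTime N = generationTime M := by
  obtain ⟨N, M', hMN, hNM', -, hgen⟩ := h.exists_coverRel_reductionRel M.as
  have key : ∀ n : ℕ, genIter (fun X => X = stab N) (n + 1) = ⊤ ↔
      genIter (fun X => X = M) (n + 1) = ⊤ := fun n =>
    ⟨fun hN => genIter_eq_top_of_gen hgen (h.genIter_eq_top_of_reductionRel hNM' hN),
      h.genIter_eq_top_of_coverRel hMN⟩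
  exact ⟨stab N, by simp only [generationTime, key]⟩

lemma exists_generationTime_eq' (h : IsDoubleCover e) (N : StableCM B) :
    ∃ M : StableCM (S ⧸ Ideal.span {f}), generationTime M = generationTime N := by
  obtain ⟨M, N', hNM, hMN', -, hgen⟩ := h.exists_reductionRel_coverRel N.as
  have key : ∀ n : ℕ, genIter (fun X => X = stab M) (n + 1) = ⊤ ↔
      genIter (fun X => X = N) (n + 1) = ⊤ := fun n =>
    ⟨fun hM => genIter_eq_top_of_gen hgen (h.genIter_eq_top_of_coverRel hMN' hM),
      h.genIter_eq_top_of_reductionRel hNM⟩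
  exact ⟨stab M, by simp only [generationTime, key]⟩

theorem orlovSpectrum_eq (h : IsDoubleCover e) :
    orlovSpectrum (S ⧸ Ideal.span {f}) = orlovSpectrum B := by
  ext t
  constructor
  · rintro ⟨M, hM, rfl⟩
    obtain ⟨N, hN⟩ := h.exists_generationTime_eq M
    exact ⟨N, hN ▸ hM, hN⟩
  · rintro ⟨N, hN, rfl⟩
    obtain ⟨M, hM⟩ := h.exists_generationTime_eq' N
    exact ⟨M, hM ▸ hN, hM⟩

end IsDoubleCover

end Comparison

/-! ## The double branched cover of a power series hypersurface -/

section DoubleBranchedCover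

open IsLocalRing MvPowerSeries

attribute [local instance] sharpAlgebra

variable {k : Type u} [Field k]

lemma exists_isDoubleCover (hk : (2 : k) ≠ 0) {n : ℕ} {f : MvPowerSeries (Fin n) k} (hf₀ : f ≠ 0)
    (hf : constantCoeff f = 0) : ∃ e : Hypersurface (sharp f) ≃ₐ[MvPowerSeries (Fin n) k]
      QuadraticAlgebra (MvPowerSeries (Fin n) k) (-f) 0, IsDoubleCover e := by
  obtain ⟨e⟩ := exists_sharp_algEquiv f hf
  have hfm : f ∈ maximalIdeal (MvPowerSeries (Fin n) k) := by
    rw [mem_maximalIdeal, mem_nonunits_iff, MvPowerSeries.isUnit_iff_constantCoeff, hf]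
    exact not_isUnit_zero
  have hfn : f ∈ nonZeroDivisors (MvPowerSeries (Fin n) k) := mem_nonZeroDivisors_of_ne_zero hf₀
  have hs : ¬ IsUnit (sharp f) := by
    rw [MvPowerSeries.isUnit_iff_constantCoeff]
    simp [sharp, hf]
  have : Nontrivial (Hypersurface (sharp f)) :=
    Ideal.Quotient.nontrivial_iff.2 (by rwa [Ne, Ideal.span_singleton_eq_top])
  have : IsLocalRing (Hypersurface (sharp f)) := .of_surjective' _ Ideal.Quotient.mk_surjective
  -- Characteristic different from two enters here: 2 is a unit of S because its constant
  -- coefficient is one.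
  exact ⟨e, inferInstance, hfn, by
      rw [MvPowerSeries.isUnit_iff_constantCoeff]
      rw [map_ofNat]
      exact isUnit_iff_ne_zero.2 hk,
    fun N => isMCM_iff_projective (isWeaklyRegular_X n).2 (isRegular_X n) hfm e N,
    fun M _ _ _ _ V _ _ _ _ p hp =>
      isMCM_quotient_iff (isWeaklyRegular_X n).2 (isRegular_X n) hfm hfn M V p hp⟩

end DoubleBranchedCover

end

end StableMCM

theorem corollary3p4 {k : Type u} [Field k] (hk : (2 : k) ≠ 0) (d : ℕ)
    (f : MvPowerSeries (Fin (d + 1)) k) (hf₀ : f ≠ 0)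
    (hf : f ∈ Ideal.span
      (Set.range (MvPowerSeries.X : Fin (d + 1) → MvPowerSeries (Fin (d + 1)) k)) ^ 2) :
    StableMCM.orlovSpectrum (StableMCM.Hypersurface f) =
        StableMCM.orlovSpectrum (StableMCM.Hypersurface (StableMCM.sharp f)) ∧
      StableMCM.rouquierDim (StableMCM.Hypersurface f) =
        StableMCM.rouquierDim (StableMCM.Hypersurface (StableMCM.sharp f)) := by
  have hf' : MvPowerSeries.constantCoeff f = 0 := by
    have hle : Ideal.span (Set.range (MvPowerSeries.X : Fin (d + 1) →
        MvPowerSeries (Fin (d + 1)) k)) ≤ RingHom.ker MvPowerSeries.constantCoeff := by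
      rw [Ideal.span_le]
      rintro _ ⟨i, rfl⟩
      simp
    exact hle (Ideal.pow_le_self two_ne_zero hf)
  let := StableMCM.sharpAlgebra f
  obtain ⟨e, he⟩ := StableMCM.exists_isDoubleCover hk hf₀ hf'
  have h := he.orlovSpectrum_eq
  exact ⟨h, by rw [StableMCM.rouquierDim, StableMCM.rouquierDim, h]⟩
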